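/- Let $\mu>0$, $\kappa=\sqrt{\mu/3}$, and let $\mathcal K^0_\mu(x)=\frac1\kappa J_0(x/\kappa)$, where $J_0(x)=\frac1\pi\int_0^\pi\cos(x\sin\theta)\,d\theta$ is the Bessel function; write $(k*_xg)(x)=\int_0^x k(x-x')g(x')\,dx'$ for causal convolution in $x\ge 0$. For $a\in\mathbb R$ let $L^2_a(\mathbb R^+)$ be the space of real functions on $(0,\infty)$ with $\int_0^\infty e^{-2ax}|u(x)|^2dx<\infty$, let $H^k_a(\mathbb R^+)$ be the space of $u\in L^2_a$ whose weak derivatives $\partial_x^l u$, $l\le k$, lie in $L^2_a$, with norm $\sum_{l\le k}|\partial_x^lu|_{L^2_a}$, and set $$\mathbb X^n_a=\bigcap_{j=0}^n C^j(\mathbb R^+_t;H^{n-j}_a(\mathbb R^+_x)),\qquad \mathbb Y^n_a=\bigcap_{j=0}^n W^{j,1}_{\rm loc}(\mathbb R^+_t;H^{n-j}_a(\mathbb R^+_x)),$$ where $\mathbb R^+=[0,\infty)$ in the time variable. Let $a>0$ and $n\in\{2,3\}$. Let $f\in\mathbb Y^n_a$, $u^{\rm in}\in H^n_a(\mathbb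 R^+)$ and $\underline u\in W^{n,1}_{\rm loc}(\mathbb R^+_t)$ (identified with its continuous representative) satisfy the two compatibility conditions $$\underline u(0)=u^{\rm in}(0),\qquad \partial_t\underline u(t)=f(t,0)\quad\text{for almost every } t>0$$ (equivalently for all $t\ge 0$, for the representative of $f$ that is continuous in time). Then the nonlocal initial boundary value problem $$\partial_t u+\mathcal K^0_\mu*_x\partial_xu=f,\qquad u_{|x=0}=\underline u,\qquad u_{|t=0}=u^{\rm in}$$ has a unique solution $u\in\mathbb X^1_a$, and this solution belongs to $\mathbb X^n_a$, without any further compatibility condition on the data. If $n=3$, then $u$ is moreover (after choosing the representative continuous in $(t,x)$) of class $C^2$ on $[0,\infty)\times[0,\infty)$. -/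

import Mathlib

open MeasureTheory Set Filter Topology
open scoped ContDiff ENNReal

namespace NonlocalTransport

noncomputable section

/-! ### Bessel kernel and causal convolution -/

/-- The Bessel function `J_n(t) = (1/π) ∫_0^π cos (n θ - t sin θ) dθ`. -/
def besselJ (n : ℕ) (t : ℝ) : ℝ :=
  (1 / Real.pi) * ∫ θ in (0 : ℝ)..Real.pi, Real.cos ((n : ℝ) * θ - t * Real.sin θ)

/-- `κ = √(μ/3)`. -/
def kappa (μ : ℝ) : ℝ := Real.sqrt (μ / 3)

/-- The kernel `𝒦⁰_μ(x) = (1/κ) J_0 (x/κ)`. -/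
def besselKernel (μ : ℝ) (x : ℝ) : ℝ := (1 / kappa μ) * besselJ 0 (x / kappa μ)

/-- Causal convolution in the space variable, `(k *ₓ g)(x) = ∫_0^x k(x - y) g(y) dy`. -/
def causalConv (k g : ℝ → ℝ) (x : ℝ) : ℝ := ∫ y in (0 : ℝ)..x, k (x - y) * g y

/-! ### Weak derivatives on the half line -/

/-- `G` is the weak (distributional) derivative of `F` on the open half line `(0, ∞)`. Used for
scalar functions of `x` and for Banach-valued functions of `t`. -/
def HasWeakDeriv {E : Type*} [NormedAddCommGroup E] [NormedSpace ℝ E] (F G : ℝ → E) : Prop :=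
  ∀ φ : ℝ → ℝ, ContDiff ℝ ∞ φ → HasCompactSupport φ → tsupport φ ⊆ Ioi 0 →
    ∫ s in Ioi (0 : ℝ), deriv φ s • F s = -∫ s in Ioi (0 : ℝ), φ s • G s

/-- `F ∈ W^{j,1}_loc([0, ∞); E)`: the weak derivatives of `F` of orders `0, …, j` exist and are
integrable on bounded intervals `[0, T]`. -/
def MemWLoc {E : Type*} [NormedAddCommGroup E] [NormedSpace ℝ E] (j : ℕ) (F : ℝ → E) : Prop :=
  ∃ G : ℕ → ℝ → E, G 0 = F ∧ (∀ i ≤ j, LocallyIntegrableOn (G i) (Ici 0)) ∧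
    ∀ i < j, HasWeakDeriv (G i) (G (i + 1))

/-! ### Weighted Sobolev spaces on the half line -/

/-- The measure `e^{-2ax} dx` on `(0, ∞)`. -/
def weightedMeasure (a : ℝ) : Measure ℝ :=
  (volume.restrict (Ioi 0)).withDensity (fun x => ENNReal.ofReal (Real.exp (-2 * a * x)))

/-- The weighted space `L²_a(ℝ⁺)`. -/
abbrev L2w (a : ℝ) : Type := Lp ℝ 2 (weightedMeasure a)

instance (a : ℝ) : IsLocallyFiniteMeasure (weightedMeasure a) :=
  IsLocallyFiniteMeasure.withDensity_ofReal (by fun_prop)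

/-- Pairing with a test function is a continuous linear functional on `L²_a`. -/
theorem exists_pairing (a : ℝ) (ψ : ℝ → ℝ) (hψ : Continuous ψ) (hc : HasCompactSupport ψ) :
    ∃ L : L2w a →L[ℝ] ℝ, ∀ w : L2w a, ∫ s in Ioi (0 : ℝ), ψ s • w s = L w := by
  have hm : MemLp (fun s => ψ s * Real.exp (2 * a * s)) 2 (weightedMeasure a) :=
    Continuous.memLp_of_hasCompactSupport (by fun_prop) hc.mul_right
  refine ⟨innerSL ℝ hm.toLp, fun w => ?_⟩
  rw [innerSL_apply_apply, L2.inner_def]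
  have h1 : ∫ s, inner ℝ ((hm.toLp _ : L2w a) s) (w s) ∂(weightedMeasure a)
      = ∫ s, (ψ s * Real.exp (2 * a * s)) * w s ∂(weightedMeasure a) := by
    refine integral_congr_ae ?_
    filter_upwards [hm.coeFn_toLp] with s hs
    rw [hs]
    simp [mul_comm]
  have h0 : ∀ g : ℝ → ℝ, ∫ s, g s ∂(weightedMeasure a)
      = ∫ s in Ioi (0 : ℝ), (ENNReal.ofReal (Real.exp (-2 * a * s))).toReal • g s := fun g =>
    integral_withDensity_eq_integral_toReal_smul (by fun_prop) (by simp) g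
  rw [h1, h0]
  refine integral_congr_ae (Eventually.of_forall fun s => ?_)
  have h2 : Real.exp (-2 * a * s) * Real.exp (2 * a * s) = 1 := by
    rw [← Real.exp_add]; simp
  simp only [smul_eq_mul, ENNReal.toReal_ofReal (Real.exp_pos _).le]
  linear_combination (-(ψ s) * w s) * h2

/-- The pairs `(w, v)` in `L²_a × L²_a` with `v` the weak derivative of `w` form the kernels of
continuous linear functionals. -/
theorem hasWeakDeriv_iff (a : ℝ) :
    ∃ I : Set (L2w a × L2w a →L[ℝ] ℝ), ∀ w v : L2w a,
      HasWeakDeriv w v ↔ ∀ L ∈ I, L (w, v) = 0 := by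
  refine ⟨{L | ∃ φ : ℝ → ℝ, ContDiff ℝ ∞ φ ∧ HasCompactSupport φ ∧ tsupport φ ⊆ Ioi 0 ∧
    ∀ w v : L2w a, L (w, v)
      = (∫ s in Ioi (0 : ℝ), deriv φ s • w s) + ∫ s in Ioi (0 : ℝ), φ s • v s}, fun w v => ?_⟩
  constructor
  · rintro h L ⟨φ, h1, h2, h3, h4⟩
    rw [h4, h φ h1 h2 h3]
    ring
  · intro h φ h1 h2 h3
    obtain ⟨A, hA⟩ := exists_pairing a (deriv φ) (h1.continuous_deriv (by simp)) h2.deriv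
    obtain ⟨B, hB⟩ := exists_pairing a φ h1.continuous h2
    have := h (A.comp (ContinuousLinearMap.fst ℝ _ _) + B.comp (ContinuousLinearMap.snd ℝ _ _))
      ⟨φ, h1, h2, h3, fun w v => by rw [hA, hB]; rfl⟩
    change A w + B v = 0 at this
    rw [hA, hB]
    linarith

/-- The weighted Sobolev space `H^k_a(ℝ⁺)`, realised as the subspace of `(L²_a)^{k+1}` of the tuples
`(w, ∂ₓw, …, ∂ₓᵏw)` with weak derivatives. Its norm `max_l |∂ₓˡ w|_{L²_a}` is equivalent to
`∑_l |∂ₓˡ w|_{L²_a}`. -/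
def Hw (a : ℝ) (k : ℕ) : Submodule ℝ (Fin (k + 1) → L2w a) where
  carrier := {w | ∀ i : Fin k, HasWeakDeriv (w i.castSucc) (w i.succ)}
  zero_mem' := by
    obtain ⟨I, hI⟩ := hasWeakDeriv_iff a
    simp only [Set.mem_ofPred_eq, hI, Pi.zero_apply]
    intro i L _
    exact map_zero L
  add_mem' := by
    obtain ⟨I, hI⟩ := hasWeakDeriv_iff a
    simp only [Set.mem_ofPred_eq, hI, Pi.add_apply]
    intro w v hw hv i L hL
    rw [← Prod.mk_add_mk, map_add, hw i L hL, hv i L hL, add_zero]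
  smul_mem' := by
    obtain ⟨I, hI⟩ := hasWeakDeriv_iff a
    simp only [Set.mem_ofPred_eq, hI, Pi.smul_apply]
    intro c w hw i L hL
    rw [← Prod.smul_mk, map_smul, hw i L hL, smul_zero]

/-- `H^k_a` is complete, so that Bochner integrals of `H^k_a`-valued functions are meaningful. -/
instance (a : ℝ) (k : ℕ) : CompleteSpace (Hw a k) := by
  have hc : IsClosed ((Hw a k : Submodule ℝ (Fin (k + 1) → L2w a)) : Set (Fin (k + 1) → L2w a)) := by
    obtain ⟨I, hI⟩ := hasWeakDeriv_iff a
    have : ((Hw a k : Submodule ℝ (Fin (k + 1) → L2w a)) : Set (Fin (k + 1) → L2w a))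
        = ⋂ (i : Fin k) (L ∈ I), {w | L (w i.castSucc, w i.succ) = 0} := by
      ext w
      simp only [mem_iInter, Set.mem_ofPred_eq]
      exact forall_congr' fun i => hI _ _
    rw [this]
    refine isClosed_iInter fun i => isClosed_biInter fun L _ => ?_
    exact isClosed_eq (by fun_prop) continuous_const
  exact hc.completeSpace_coe

/-- The inclusion `H^k_a ⊆ L²_a`. -/
def toL2 {a : ℝ} {k : ℕ} (w : Hw a k) : L2w a := w.1 0

/-- `w` has trace `c` at `x = 0`: it has a representative continuous on `[0, ∞)`, with value `c`
at `0`. -/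
def HasTrace {a : ℝ} (w : L2w a) (c : ℝ) : Prop :=
  ∃ g : ℝ → ℝ, ContinuousOn g (Ici 0) ∧ (∀ᵐ x ∂(volume.restrict (Ioi 0)), w x = g x) ∧ g 0 = c

/-! ### Space-time functional spaces -/

/-- `u ∈ 𝕏ⁿ_a = ⋂_{j ≤ n} C^j([0, ∞)_t; H^{n-j}_a)`. -/
def MemX (a : ℝ) (n : ℕ) (u : ℝ → L2w a) : Prop :=
  ∀ j ≤ n, ∃ U : ℝ → Hw a (n - j), ContDiffOn ℝ j U (Ici 0) ∧ ∀ t ≥ 0, toL2 (U t) = u t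

/-- `f ∈ 𝕐ⁿ_a = ⋂_{j ≤ n} W^{j,1}_loc([0, ∞)_t; H^{n-j}_a)` (functions defined for almost every
`t`). -/
def MemY (a : ℝ) (n : ℕ) (f : ℝ → L2w a) : Prop :=
  ∀ j ≤ n, ∃ F : ℝ → Hw a (n - j), MemWLoc j F ∧
    ∀ᵐ t ∂(volume.restrict (Ioi 0)), toL2 (F t) = f t

/-- `u` solves `∂ₜu + 𝒦⁰_μ *ₓ ∂ₓu = f`, `u|_{x=0} = ubar`, `u|_{t=0} = uin`. The equation is
required in `L²_a` for almost every time `t > 0`. -/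
structure IsSolution (μ a : ℝ) (f : ℝ → L2w a) (ubar : ℝ → ℝ) (uin : L2w a) (u : ℝ → L2w a) :
    Prop where
  equation : ∀ᵐ t ∂(volume.restrict (Ioi 0)), ∃ ut ux : L2w a,
    HasDerivAt u ut t ∧ HasWeakDeriv (u t) ux ∧
      ∀ᵐ x ∂(volume.restrict (Ioi 0)), ut x + causalConv (besselKernel μ) ux x = f t x
  boundary : ∀ t ≥ 0, HasTrace (u t) (ubar t)
  initial : u 0 = uin

end

end NonlocalTransport

open MeasureTheory Set Filter Topology
open scoped ContDiff ENNReal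

namespace NonlocalTransport

noncomputable section

/-! ### Locally integrable functions on the half line and their primitives -/

section Primitive

variable {E : Type*} [NormedAddCommGroup E]

/-! Write k for the kernel. It is smooth and bounded with all its derivatives, so integration by
parts removes the space derivative: k *ₓ ∂ₓu = k(0) u + k' *ₓ u - k(x) u(t,0)
(`causalConv_integration_by_parts`, `causalConv_weakDeriv`). Since u(t,0) is prescribed, the
equation becomes a linear ODE ∂ₜu = A u + f + ubar(t) k, with A w = -(k(0) w + k' *ₓ w).

For a > 0, convolution with a bounded kernel is bounded on L²_a, by a weighted Hardy inequality
(`weighted_hardy`). Because (k *ₓ w)' = k(0) w + k' *ₓ w puts no derivative on w, A is bounded on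
every H^k_a, without any condition at x = 0. The kernel itself lies in every H^k_a, as the weight
has finite mass. Hence the ODE is solved once in H^n_a (`exists_linear_ode_solution`). Read in
H^{n-j}_a, where f is C^{j-1} in time, the same solution is C^j (`exists_reduced_solution`).

It remains to recover the boundary condition. A convolution has zero trace, so y(t) = u(t,0)
satisfies y' = -k(0) y + f(t,0) + k(0) ubar. If f(t,0) = ubar', the defect y - ubar solves a
homogeneous scalar ODE, and it vanishes initially if ubar(0) = uin(0). These are exactly the two
compatibility conditions, and no other is needed (`exists_solution`).

Uniqueness is Grönwall's lemma in L²_a: the boundary terms of two solutions cancel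
(`IsSolution.unique`). For n = 3 all second derivatives are continuous in time with values in H^1_a,
where point evaluation is jointly continuous, so u is C² (`exists_contDiffOn_two_of_memX`). -/

theorem intervalIntegrable_of_locallyIntegrableOn {G : ℝ → E}
    (hG : LocallyIntegrableOn G (Ici 0)) {x y : ℝ} (hx : 0 ≤ x) (hy : 0 ≤ y) :
    IntervalIntegrable G volume x y :=
  (hG.integrableOn_compact_subset (fun _ hz => (le_min hx hy).trans hz.1)
    isCompact_uIcc).intervalIntegrable

variable [NormedSpace ℝ E]

theorem integrable_smul_of_locallyIntegrableOn {G : ℝ → E}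
    (hG : LocallyIntegrableOn G (Ici 0)) {ψ : ℝ → ℝ} (hψ : Continuous ψ)
    (hc : HasCompactSupport ψ) : IntegrableOn (fun s => ψ s • G s) (Ioi 0) := by
  rw [locallyIntegrableOn_iff_locallyIntegrable_restrict isClosed_Ici] at hG
  have := hG.integrable_smul_left_of_hasCompactSupport hψ hc
  exact IntegrableOn.mono_set (t := Ici 0) this Ioi_subset_Ici_self

theorem continuousOn_primitive {G : ℝ → E} (hG : LocallyIntegrableOn G (Ici 0)) :
    ContinuousOn (fun x => ∫ s in (0 : ℝ)..x, G s) (Ici 0) := by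
  intro x hx
  have h1 : ContinuousOn (fun x => ∫ s in (0 : ℝ)..x, G s) (Icc 0 (x + 1)) := by
    have := intervalIntegral.continuousOn_primitive_interval (a := 0) (b := x + 1) (f := G)
      (μ := volume) (hG.integrableOn_compact_subset
        (by rw [uIcc_of_le (by linarith [mem_Ici.1 hx])]; exact Icc_subset_Ici_self)
        isCompact_uIcc)
    rwa [uIcc_of_le (by linarith [mem_Ici.1 hx])] at this
  refine (h1 x ⟨hx, by linarith⟩).mono_of_mem_nhdsWithin ?_
  rw [← Ici_inter_Iic]
  exact inter_mem_nhdsWithin _ (Iic_mem_nhds (by linarith))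

theorem exists_support_bound {φ : ℝ → ℝ} (hc : HasCompactSupport φ) (hs : tsupport φ ⊆ Ioi 0) :
    ∃ α β : ℝ, 0 < α ∧ α < β ∧ ∀ s, s ∉ Icc α β → φ s = 0 := by
  obtain ⟨R, hR⟩ := hc.isCompact.bddAbove
  rcases (tsupport φ).eq_empty_or_nonempty with h | h
  · exact ⟨1, 2, one_pos, one_lt_two, fun s _ => image_eq_zero_of_notMem_tsupport (by simp [h])⟩
  · obtain ⟨α, hα, hm⟩ := hc.isCompact.exists_isLeast h
    refine ⟨α, R + 1, hs hα, (hR hα).trans_lt (lt_add_one R), fun s hs' => ?_⟩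
    refine image_eq_zero_of_notMem_tsupport fun h' => hs' ⟨hm h', (hR h').trans ?_⟩
    linarith

theorem integral_Ioi_eq_intervalIntegral {f : ℝ → E} {R : ℝ} (hR : 0 ≤ R)
    (hf : ∀ s, R < s → f s = 0) : ∫ s in Ioi (0 : ℝ), f s = ∫ s in (0 : ℝ)..R, f s := by
  rw [intervalIntegral.integral_of_le hR]
  refine (setIntegral_eq_of_subset_of_forall_sdiff_eq_zero measurableSet_Ioi Ioc_subset_Ioi_self
    fun s hs => hf s ?_)
  by_contra h
  exact hs.2 ⟨hs.1, not_lt.1 h⟩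

theorem HasWeakDeriv.congr {F F' G G' : ℝ → E} (h : HasWeakDeriv F G)
    (hF : ∀ᵐ s ∂(volume.restrict (Ioi 0)), F s = F' s)
    (hG : ∀ᵐ s ∂(volume.restrict (Ioi 0)), G s = G' s) : HasWeakDeriv F' G' := by
  intro φ h1 h2 h3
  have e1 : ∫ s in Ioi (0 : ℝ), deriv φ s • F' s = ∫ s in Ioi (0 : ℝ), deriv φ s • F s :=
    integral_congr_ae (by filter_upwards [hF] with s hs; rw [hs])
  have e2 : ∫ s in Ioi (0 : ℝ), φ s • G' s = ∫ s in Ioi (0 : ℝ), φ s • G s :=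
    integral_congr_ae (by filter_upwards [hG] with s hs; rw [hs])
  rw [e1, e2, h φ h1 h2 h3]

theorem HasWeakDeriv.sub {F F' G G' : ℝ → E} (h : HasWeakDeriv F G) (h' : HasWeakDeriv F' G')
    (hF : LocallyIntegrableOn F (Ici 0)) (hG : LocallyIntegrableOn G (Ici 0))
    (hF' : LocallyIntegrableOn F' (Ici 0)) (hG' : LocallyIntegrableOn G' (Ici 0)) :
    HasWeakDeriv (fun s => F s - F' s) (fun s => G s - G' s) := by
  intro φ h1 h2 h3
  have hd : Continuous (deriv φ) := h1.continuous_deriv (by simp)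
  simp only [smul_sub]
  rw [integral_sub (integrable_smul_of_locallyIntegrableOn hF hd h2.deriv)
      (integrable_smul_of_locallyIntegrableOn hF' hd h2.deriv),
    integral_sub (integrable_smul_of_locallyIntegrableOn hG h1.continuous h2)
      (integrable_smul_of_locallyIntegrableOn hG' h1.continuous h2), h φ h1 h2 h3, h' φ h1 h2 h3]
  abel

variable [CompleteSpace E]

/-- Fubini on the triangle 0 ≤ y ≤ z ≤ x, for a merely integrable `g`. It underlies the weak
derivative of a primitive and both convolution identities. -/
theorem integral_triangle_swap {K : ℝ → ℝ → ℝ} (hK : Continuous K.uncurry) {g : ℝ → E} {x : ℝ}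
    (hx : 0 ≤ x) (hg : IntervalIntegrable g volume 0 x) :
    ∫ z in (0 : ℝ)..x, ∫ y in (0 : ℝ)..z, K z y • g y
      = ∫ y in (0 : ℝ)..x, (∫ z in y..x, K z y) • g y := by
  -- The integrand is extended by zero from the triangle to the square.
  set H : ℝ → ℝ → E := fun z y => (Iic z).indicator (fun y => K z y • g y) y with hH
  have hHu : H.uncurry = {p : ℝ × ℝ | p.2 ≤ p.1}.indicator (fun p => K.uncurry p • g p.2) := by
    ext ⟨z, y⟩
    simp [hH, indicator, Function.uncurry]
  have hint : IntegrableOn H.uncurry (uIoc 0 x ×ˢ uIoc 0 x) := by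
    rw [hHu]
    refine IntegrableOn.indicator ?_ (measurableSet_le measurable_snd measurable_fst)
    have : IsFiniteMeasure (volume.restrict (uIoc 0 x)) := by
      rw [uIoc_of_le hx]; infer_instance
    have hg2 : Integrable (fun p : ℝ × ℝ => g p.2)
        ((volume.restrict (uIoc 0 x)).prod (volume.restrict (uIoc 0 x))) :=
      Integrable.comp_snd hg.def' _
    rw [Measure.prod_restrict, ← Measure.volume_eq_prod] at hg2
    obtain ⟨C, hC⟩ := ((isCompact_uIcc (a := (0 : ℝ)) (b := x)).prod
      (isCompact_uIcc (a := (0 : ℝ)) (b := x))).exists_bound_of_continuousOn hK.continuousOn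
    refine Integrable.bdd_smul hg2 C hK.aestronglyMeasurable ?_
    filter_upwards [ae_restrict_mem (measurableSet_uIoc.prod measurableSet_uIoc)] with p hp
    exact hC p ⟨uIoc_subset_uIcc hp.1, uIoc_subset_uIcc hp.2⟩
  have h1 : ∫ z in (0 : ℝ)..x, ∫ y in (0 : ℝ)..z, K z y • g y
      = ∫ z in (0 : ℝ)..x, ∫ y in (0 : ℝ)..x, H z y := by
    refine intervalIntegral.integral_congr fun z hz => ?_
    rw [uIcc_of_le hx] at hz
    simp only [hH]
    rw [intervalIntegral.integral_of_le hz.1, intervalIntegral.integral_of_le hx,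
      setIntegral_indicator measurableSet_Iic, Ioc_inter_Iic, min_eq_right hz.2]
  have h2 : ∫ y in (0 : ℝ)..x, (∫ z in y..x, K z y) • g y
      = ∫ y in (0 : ℝ)..x, ∫ z in (0 : ℝ)..x, H z y := by
    refine intervalIntegral.integral_congr fun y hy => ?_
    rw [uIcc_of_le hx] at hy
    have : ∀ z, H z y = (Ici y).indicator (fun z => K z y • g y) z := fun z => by
      simp [hH, indicator]
    simp only [this]
    rw [← intervalIntegral.integral_smul_const, intervalIntegral.integral_of_le hy.2,
      intervalIntegral.integral_of_le hx, integral_indicator measurableSet_Ici,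
      Measure.restrict_restrict measurableSet_Ici, ← integral_Icc_eq_integral_Ioc]
    refine setIntegral_congr_set ?_
    have : (Ici y ∩ Icc 0 x : Set ℝ) = Icc y x := by
      ext z; simp only [mem_inter_iff, mem_Ici, mem_Icc]
      constructor
      · rintro ⟨h, -, h'⟩; exact ⟨h, h'⟩
      · rintro ⟨h, h'⟩; exact ⟨h, hy.1.trans h, h'⟩
    rw [← this]
    exact (ae_eq_refl _).inter Ioc_ae_eq_Icc.symm
  rw [h1, h2, intervalIntegral_intervalIntegral_swap hint]

/-- The test function need not vanish at 0: the boundary term `φ 0 • c` is what later expresses the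
trace through integrals. -/
theorem integral_deriv_smul_primitive {G : ℝ → E} (hG : LocallyIntegrableOn G (Ici 0)) (c : E)
    {φ : ℝ → ℝ} (h1 : ContDiff ℝ ∞ φ) (h2 : HasCompactSupport φ) :
    ∫ x in Ioi (0 : ℝ), deriv φ x • (c + ∫ s in (0 : ℝ)..x, G s)
      = -(φ 0 • c) - ∫ s in Ioi (0 : ℝ), φ s • G s := by
  obtain ⟨R, hR0, hR⟩ : ∃ R : ℝ, 0 ≤ R ∧ ∀ s, R < s → φ s = 0 := by
    obtain ⟨R, hR⟩ := h2.isCompact.bddAbove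
    refine ⟨max R 0, le_max_right _ _, fun s hs => image_eq_zero_of_notMem_tsupport fun h => ?_⟩
    exact absurd (hR h) (not_le.2 ((le_max_left _ _).trans_lt hs))
  have hφR : φ (R + 1) = 0 := hR _ (lt_add_one R)
  have hd : Continuous (deriv φ) := h1.continuous_deriv (by simp)
  have hφ' : ∀ s, R + 1 < s → deriv φ s = 0 := fun s hs => by
    have : φ =ᶠ[𝓝 s] fun _ => 0 := by
      filter_upwards [Ioi_mem_nhds hs] with r hr
      exact hR r ((lt_add_one R).trans hr)
    rw [this.deriv_eq, deriv_const]
  have hprim : ∀ r, ∫ z in r..(R + 1), deriv φ z = - φ r := fun r => by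
    rw [intervalIntegral.integral_deriv_eq_sub (fun z _ => (h1.differentiable (by simp)) z)
      (hd.intervalIntegrable _ _), hφR, zero_sub]
  have hβ : 0 ≤ R + 1 := by linarith
  rw [integral_Ioi_eq_intervalIntegral hβ fun s hs => by rw [hφ' s hs, zero_smul],
    integral_Ioi_eq_intervalIntegral hβ fun s hs => by
      rw [hR s ((lt_add_one R).trans hs), zero_smul]]
  simp only [smul_add]
  have i1 : IntervalIntegrable (fun s => deriv φ s • c) volume 0 (R + 1) :=
    (hd.smul continuous_const).intervalIntegrable _ _
  have i2 : IntervalIntegrable (fun s => deriv φ s • ∫ r in (0 : ℝ)..s, G r) volume 0 (R + 1) :=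
    ContinuousOn.intervalIntegrable (by
      rw [uIcc_of_le hβ]
      exact hd.continuousOn.smul ((continuousOn_primitive hG).mono Icc_subset_Ici_self))
  rw [intervalIntegral.integral_add i1 i2, intervalIntegral.integral_smul_const, hprim, neg_smul]
  have := integral_triangle_swap (K := fun z _ => deriv φ z) (hd.comp continuous_fst) hβ
    (intervalIntegrable_of_locallyIntegrableOn hG le_rfl hβ)
  simp only [intervalIntegral.integral_smul, hprim, neg_smul,
    intervalIntegral.integral_neg] at this
  rw [this]
  abel

theorem hasWeakDeriv_primitive {G : ℝ → E} (hG : LocallyIntegrableOn G (Ici 0)) (c : E) :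
    HasWeakDeriv (fun x => c + ∫ s in (0 : ℝ)..x, G s) G := by
  intro φ h1 h2 h3
  have h0 : φ 0 = 0 := image_eq_zero_of_notMem_tsupport fun h => lt_irrefl (0 : ℝ) (h3 h)
  rw [integral_deriv_smul_primitive hG c h1 h2, h0, zero_smul, neg_zero, zero_sub]

theorem ae_eq_zero_of_hasWeakDeriv {F G : ℝ → E} (hG : LocallyIntegrableOn G (Ici 0))
    (hF : ∀ᵐ s ∂(volume.restrict (Ioi 0)), F s = 0) (h : HasWeakDeriv F G) :
    ∀ᵐ s ∂(volume.restrict (Ioi 0)), G s = 0 := by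
  have := isOpen_Ioi.ae_eq_zero_of_integral_contDiff_smul_eq_zero (U := Ioi (0 : ℝ))
    (hG.mono_set Ioi_subset_Ici_self) (μ := volume) fun φ h1 h2 h3 => by
      rw [← setIntegral_eq_integral_of_forall_compl_eq_zero (s := Ioi (0 : ℝ)) fun s hs => by
        rw [image_eq_zero_of_notMem_tsupport fun h' => hs (h3 h'), zero_smul]]
      have e := h φ h1 h2 h3
      rw [integral_congr_ae (g := fun _ => (0 : E))
        (by filter_upwards [hF] with s hs; rw [hs, smul_zero]), integral_zero] at e
      exact neg_eq_zero.1 e.symm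
  exact (ae_restrict_iff' measurableSet_Ioi).2 this

/-- The du Bois-Reymond argument: for a fixed test function r of integral 1, φ - (∫φ) r has mean
zero, hence is the derivative of a test function P. Therefore ∫ φ F = (∫ φ) ∫ r F. -/
theorem exists_ae_eq_const {F : ℝ → E} (hF : LocallyIntegrableOn F (Ici 0))
    (h : HasWeakDeriv F fun _ => 0) :
    ∃ c : E, ∀ᵐ s ∂(volume.restrict (Ioi 0)), F s = c := by
  -- Centre 2 and outer radius 1 keep the support in [1, 3], away from 0.
  obtain ⟨ρ, hρ⟩ : ∃ ρ : ContDiffBump (2 : ℝ), ρ.rOut = 1 :=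
    ⟨⟨1 / 2, 1, by norm_num, by norm_num⟩, rfl⟩
  set r : ℝ → ℝ := ρ.normed volume
  have hr1 : ContDiff ℝ ∞ r := ρ.contDiff_normed
  have hr2 : HasCompactSupport r := ρ.hasCompactSupport_normed
  have hr3 : tsupport r ⊆ Ioi 0 := by
    rw [ρ.tsupport_normed_eq, hρ, Real.closedBall_eq_Icc]
    intro s hs
    have := hs.1
    simp only [mem_Ioi]
    linarith
  have hr4 : ∫ s in Ioi (0 : ℝ), r s = 1 := by
    rw [setIntegral_eq_integral_of_forall_compl_eq_zero fun s hs =>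
      image_eq_zero_of_notMem_tsupport fun h' => hs (hr3 h')]
    exact ρ.integral_normed
  set c : E := ∫ s in Ioi (0 : ℝ), r s • F s
  refine ⟨c, ?_⟩
  have hcl : LocallyIntegrableOn (fun _ : ℝ => c) (Ici 0) :=
    (locallyIntegrable_const c).locallyIntegrableOn _
  have key : ∀ φ : ℝ → ℝ, ContDiff ℝ ∞ φ → HasCompactSupport φ → tsupport φ ⊆ Ioi 0 →
      ∫ s in Ioi (0 : ℝ), φ s • (F s - c) = 0 := by
    intro φ h1 h2 h3
    set m : ℝ := ∫ s in Ioi (0 : ℝ), φ s with hm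
    set ψ : ℝ → ℝ := fun s => φ s - m * r s with hψ
    have hψ1 : ContDiff ℝ ∞ ψ := h1.sub (contDiff_const.mul hr1)
    have hψ2 : HasCompactSupport ψ := h2.sub hr2.mul_left
    have hψ3 : tsupport ψ ⊆ Ioi 0 := by
      refine (tsupport_sub _ _).trans (union_subset h3 (Subset.trans ?_ hr3))
      exact tsupport_mul_subset_right
    have i1 : IntegrableOn φ (Ioi 0) :=
      (h1.continuous.integrable_of_hasCompactSupport h2).integrableOn
    have i2 : IntegrableOn r (Ioi 0) :=
      (hr1.continuous.integrable_of_hasCompactSupport hr2).integrableOn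
    obtain ⟨α, β, hα, hαβ, hz⟩ := exists_support_bound hψ2 hψ3
    have hψ4 : ∫ s in (0 : ℝ)..β, ψ s = 0 := by
      rw [← integral_Ioi_eq_intervalIntegral (by linarith) fun s hs => hz s fun h' => by
        linarith [h'.2], hψ, integral_sub i1 (i2.const_mul m), integral_const_mul, hr4]
      simp [hm]
    set P : ℝ → ℝ := fun x => ∫ s in (0 : ℝ)..x, ψ s with hP
    have hPd : ∀ x, HasDerivAt P (ψ x) x := fun x =>
      intervalIntegral.integral_hasDerivAt_right (hψ1.continuous.intervalIntegrable _ _)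
        hψ1.continuous.stronglyMeasurable.stronglyMeasurableAtFilter hψ1.continuous.continuousAt
    have hPd' : deriv P = ψ := funext fun x => (hPd x).deriv
    have hP1 : ContDiff ℝ ∞ P := by
      rw [contDiff_infty_iff_deriv, hPd']
      exact ⟨fun x => (hPd x).differentiableAt, hψ1⟩
    -- To the right of β this uses that ψ has mean zero.
    have hP0 : ∀ x, x ∉ Icc α β → P x = 0 := by
      intro x hx
      rcases lt_or_ge x α with hxα | hxα
      · simp only [hP]
        rw [intervalIntegral.integral_congr (g := fun _ => 0), intervalIntegral.integral_zero]
        intro s hs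
        refine hz s fun h' => ?_
        have := hs.2
        have : s ≤ max 0 x := this
        exact absurd (h'.1.trans this) (not_le.2 (max_lt hα hxα))
      · have hxβ : β < x := not_le.1 fun h' => hx ⟨hxα, h'⟩
        simp only [hP]
        rw [← intervalIntegral.integral_add_adjacent_intervals (b := β)
          (hψ1.continuous.intervalIntegrable _ _) (hψ1.continuous.intervalIntegrable _ _), hψ4,
          zero_add]
        refine intervalIntegral.integral_zero_ae (Eventually.of_forall fun s hs => hz s fun h' => ?_)
        rw [uIoc_of_le hxβ.le] at hs
        linarith [hs.1, h'.2]
    have hP3 : tsupport P ⊆ Icc α β := closure_minimal (fun x hx => by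
      by_contra h'
      exact hx (hP0 x h')) isClosed_Icc
    have hP2 : HasCompactSupport P := HasCompactSupport.of_support_subset_isCompact isCompact_Icc
      (subset_closure.trans hP3)
    have e := h P hP1 hP2 (hP3.trans fun s hs => hα.trans_le hs.1)
    simp only [smul_zero, integral_zero, neg_zero, hPd'] at e
    have j1 := integrable_smul_of_locallyIntegrableOn hF h1.continuous h2
    have j2 := integrable_smul_of_locallyIntegrableOn hF hr1.continuous hr2
    have e2 : ∫ s in Ioi (0 : ℝ), ψ s • F s = (∫ s in Ioi (0 : ℝ), φ s • F s) - m • c := by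
      simp only [hψ, sub_smul, mul_smul]
      rw [← integral_smul]
      exact integral_sub j1 (j2.smul m)
    simp only [smul_sub]
    rw [integral_sub j1 (integrable_smul_of_locallyIntegrableOn hcl h1.continuous h2),
      integral_smul_const, ← hm, ← e2, e]
  have := isOpen_Ioi.ae_eq_zero_of_integral_contDiff_smul_eq_zero (U := Ioi (0 : ℝ))
    (f := fun s => F s - c) ((hF.sub hcl).mono_set Ioi_subset_Ici_self) (μ := volume)
    fun φ h1 h2 h3 => by
      rw [← setIntegral_eq_integral_of_forall_compl_eq_zero (s := Ioi (0 : ℝ)) fun s hs => by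
        rw [image_eq_zero_of_notMem_tsupport fun h' => hs (h3 h'), zero_smul]]
      exact key φ h1 h2 h3
  filter_upwards [(ae_restrict_iff' measurableSet_Ioi).2 this] with s hs
  exact sub_eq_zero.1 hs

/-- Subtracting the primitive of `G` leaves a function with zero weak derivative. -/
theorem exists_ae_eq_primitive {F G : ℝ → E} (hF : LocallyIntegrableOn F (Ici 0))
    (hG : LocallyIntegrableOn G (Ici 0)) (h : HasWeakDeriv F G) :
    ∃ c : E, ∀ᵐ s ∂(volume.restrict (Ioi 0)), F s = c + ∫ r in (0 : ℝ)..s, G r := by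
  have hP : LocallyIntegrableOn (fun x => 0 + ∫ s in (0 : ℝ)..x, G s) (Ici 0) :=
    (continuousOn_const.add (continuousOn_primitive hG)).locallyIntegrableOn measurableSet_Ici
  obtain ⟨c, hc⟩ := exists_ae_eq_const (hF.sub hP) <| by
    have := h.sub (hasWeakDeriv_primitive hG 0) hF hG hP hG
    simp only [sub_self] at this
    exact this
  refine ⟨c, ?_⟩
  filter_upwards [hc] with s hs
  rw [← hs]
  simp only [Pi.sub_apply]
  abel

end Primitive

/-! ### Calculus in time on the half line -/

section Time

variable {E : Type*} [NormedAddCommGroup E]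

theorem eqOn_Ici_of_ae_eq {f g : ℝ → E} (h : ∀ᵐ s ∂(volume.restrict (Ioi (0 : ℝ))), f s = g s)
    (hf : ContinuousOn f (Ici 0)) (hg : ContinuousOn g (Ici 0)) : EqOn f g (Ici 0) := by
  refine Measure.eqOn_of_ae_eq (μ := volume) ?_ hf hg ?_
  · rw [← restrict_Ioi_eq_restrict_Ici]
    exact h
  · rw [interior_Ici, closure_Ioi]

theorem _root_.ContinuousOn.locallyIntegrableOn_Ici {g : ℝ → E} (hg : ContinuousOn g (Ici 0)) :
    LocallyIntegrableOn g (Ici 0) := hg.locallyIntegrableOn measurableSet_Ici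

variable [NormedSpace ℝ E]

theorem intervalIntegral_congr_ae_Ioi {f g : ℝ → E} {t : ℝ} (ht : 0 ≤ t)
    (h : ∀ᵐ s ∂(volume.restrict (Ioi (0 : ℝ))), f s = g s) :
    ∫ s in (0 : ℝ)..t, f s = ∫ s in (0 : ℝ)..t, g s := by
  rw [intervalIntegral.integral_of_le ht, intervalIntegral.integral_of_le ht]
  exact integral_congr_ae (ae_restrict_of_ae_restrict_of_subset Ioc_subset_Ioi_self h)

theorem contDiffOn_succ_of_hasDerivWithinAt {u g : ℝ → E} {j : ℕ}
    (h : ∀ t ≥ 0, HasDerivWithinAt u (g t) (Ici 0) t) (hg : ContDiffOn ℝ j g (Ici 0)) :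
    ContDiffOn ℝ ((j + 1 : ℕ) : WithTop ℕ∞) u (Ici 0) := by
  push_cast
  rw [contDiffOn_succ_iff_derivWithin (uniqueDiffOn_Ici 0)]
  refine ⟨fun t ht => (h t ht).differentiableWithinAt, by simp, hg.congr fun t ht => ?_⟩
  exact (h t ht).derivWithin (uniqueDiffOn_Ici 0 t ht)

theorem exists_hasDerivWithinAt_of_contDiffOn {u : ℝ → E} {j : ℕ}
    (hu : ContDiffOn ℝ ((j + 1 : ℕ) : WithTop ℕ∞) u (Ici 0)) :
    ∃ g : ℝ → E, ContDiffOn ℝ j g (Ici 0) ∧ ∀ t ≥ 0, HasDerivWithinAt u (g t) (Ici 0) t := by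
  push_cast at hu
  rw [contDiffOn_succ_iff_derivWithin (uniqueDiffOn_Ici 0)] at hu
  exact ⟨_, hu.2.2, fun t ht => (hu.1 t ht).hasDerivWithinAt⟩

variable [CompleteSpace E]

theorem hasDerivWithinAt_primitive {g : ℝ → E} (hg : ContinuousOn g (Ici 0)) (c : E) {t : ℝ}
    (ht : 0 ≤ t) :
    HasDerivWithinAt (fun x => c + ∫ s in (0 : ℝ)..x, g s) (g t) (Ici 0) t := by
  -- Extending `g` by its value at 0 gives a two-sided derivative, also at t = 0.
  have hc : Continuous fun s : ℝ => g (max 0 s) :=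
    hg.comp_continuous (by fun_prop) fun s => le_max_left 0 s
  have h1 : HasDerivAt (fun x => c + ∫ s in (0 : ℝ)..x, g (max 0 s)) (g (max 0 t)) t :=
    (intervalIntegral.integral_hasDerivAt_right (hc.intervalIntegrable _ _)
      hc.stronglyMeasurable.stronglyMeasurableAtFilter hc.continuousAt).const_add c
  rw [max_eq_right ht] at h1
  refine h1.hasDerivWithinAt.congr_of_mem (fun x hx => ?_) ht
  congr 1
  refine intervalIntegral.integral_congr fun s hs => ?_
  rw [uIcc_of_le hx] at hs
  simp only [max_eq_right hs.1]

theorem contDiffOn_primitive {g : ℝ → E} {j : ℕ} (hg : ContDiffOn ℝ j g (Ici 0)) (c : E) :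
    ContDiffOn ℝ ((j + 1 : ℕ) : WithTop ℕ∞) (fun x => c + ∫ s in (0 : ℝ)..x, g s) (Ici 0) :=
  contDiffOn_succ_of_hasDerivWithinAt
    (fun _ ht => hasDerivWithinAt_primitive hg.continuousOn c ht) hg

theorem eq_add_integral_of_hasDerivWithinAt {u g : ℝ → E}
    (h : ∀ t ≥ 0, HasDerivWithinAt u (g t) (Ici 0) t) (hg : ContinuousOn g (Ici 0)) {t : ℝ}
    (ht : 0 ≤ t) : u t = u 0 + ∫ s in (0 : ℝ)..t, g s := by
  rw [intervalIntegral.integral_eq_sub_of_hasDeriv_right_of_le ht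
    (fun s hs => ((h s hs.1).continuousWithinAt).mono Icc_subset_Ici_self)
    (fun s hs => (h s hs.1.le).mono (Ioi_subset_Ici_self.trans (Ici_subset_Ici.2 hs.1.le)))
    (intervalIntegrable_of_locallyIntegrableOn hg.locallyIntegrableOn_Ici le_rfl ht)]
  abel

/-- One order is lost because the top derivative is only integrable; the representative is obtained
by repeated integration. -/
theorem MemWLoc.exists_contDiffOn {j : ℕ} {F : ℝ → E} (hF : MemWLoc (j + 1) F) :
    ∃ F' : ℝ → E, ContDiffOn ℝ j F' (Ici 0) ∧ ∀ᵐ t ∂(volume.restrict (Ioi 0)), F t = F' t := by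
  induction j generalizing F with
  | zero =>
    obtain ⟨G, rfl, hG, hw⟩ := hF
    obtain ⟨c, hc⟩ := exists_ae_eq_primitive (hG 0 (by omega)) (hG 1 (by omega)) (hw 0 (by omega))
    refine ⟨_, ?_, hc⟩
    exact contDiffOn_zero.2 (continuousOn_const.add (continuousOn_primitive (hG 1 le_rfl)))
  | succ j ih =>
    obtain ⟨G, rfl, hG, hw⟩ := hF
    obtain ⟨c, hc⟩ := exists_ae_eq_primitive (hG 0 (by omega)) (hG 1 (by omega)) (hw 0 (by omega))
    obtain ⟨g, hg, hge⟩ := ih (F := G 1)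
      ⟨fun i => G (i + 1), rfl, fun i hi => hG _ (by omega), fun i hi => hw _ (by omega)⟩
    refine ⟨_, contDiffOn_primitive hg c, ?_⟩
    filter_upwards [hc, ae_restrict_mem measurableSet_Ioi] with t ht ht0
    rw [ht, intervalIntegral_congr_ae_Ioi (le_of_lt ht0) hge]

theorem MemWLoc.exists_hasDerivWithinAt {j : ℕ} {F : ℝ → E} (hF : MemWLoc (j + 2) F)
    (hc : ContinuousOn F (Ici 0)) :
    ∃ g : ℝ → E, ContDiffOn ℝ j g (Ici 0) ∧ ∀ t ≥ 0, HasDerivWithinAt F (g t) (Ici 0) t := by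
  obtain ⟨F', hF', he⟩ := hF.exists_contDiffOn
  have := eqOn_Ici_of_ae_eq he hc hF'.continuousOn
  exact exists_hasDerivWithinAt_of_contDiffOn (hF'.congr this)

/-- Grönwall. The integral form suits equations known only for almost every time. -/
theorem eq_zero_of_eq_integral (A : E →L[ℝ] E) {w : ℝ → E} (hw : ContinuousOn w (Ici 0))
    (h : ∀ t ≥ 0, w t = ∫ s in (0 : ℝ)..t, A (w s)) {t : ℝ} (ht : 0 ≤ t) : w t = 0 := by
  have hA : ContinuousOn (fun s => A (w s)) (Ici 0) := A.continuous.comp_continuousOn hw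
  refine eq_zero_of_abs_deriv_le_mul_abs_self_of_eq_zero_right (f := w) (f' := fun s => A (w s))
    (K := ‖A‖) (a := 0) (b := t) (hw.mono Icc_subset_Ici_self) (fun s hs => ?_)
    (by simpa using h 0 le_rfl) (fun s _ => A.le_opNorm _) t ⟨ht, le_rfl⟩
  have := hasDerivWithinAt_primitive hA 0 hs.1
  refine (this.congr_of_mem (fun r hr => ?_) hs.1).mono (Ici_subset_Ici.2 hs.1)
  rw [zero_add]
  exact h r hr

/-- As `g` is only integrable, the solution need not be C¹. Writing u = G + w, with G the initial
value plus the primitive of `g`, leaves w' = A (G + w), w(0) = 0, whose source is continuous; w is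
then given by Duhamel's formula. -/
theorem exists_linear_ode_solution (A : E →L[ℝ] E) (u₀ : E) {g : ℝ → E}
    (hg : LocallyIntegrableOn g (Ici 0)) :
    ∃ u : ℝ → E, ContinuousOn u (Ici 0) ∧
      ∀ t ≥ 0, u t = u₀ + (∫ s in (0 : ℝ)..t, A (u s)) + ∫ s in (0 : ℝ)..t, g s := by
  set G : ℝ → E := fun t => u₀ + ∫ s in (0 : ℝ)..t, g s with hG
  have hGc : ContinuousOn G (Ici 0) := continuousOn_const.add (continuousOn_primitive hg)
  set S : ℝ → E →L[ℝ] E := fun t => NormedSpace.exp (t • A) with hS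
  have hSd : ∀ t, HasDerivAt S (A * S t) t := fun t => hasDerivAt_exp_smul_const' A t
  have hSc : Continuous S := continuous_iff_continuousAt.2 fun t => (hSd t).continuousAt
  have hSS : ∀ t x, S t (S (-t) x) = x := fun t x => by
    have : S t * S (-t) = 1 := by
      let := NormedAlgebra.restrictScalars ℚ ℝ (E →L[ℝ] E)
      simp only [hS]
      rw [← NormedSpace.exp_add_of_commute (((Commute.refl A).smul_left _).smul_right _),
        neg_smul, add_neg_cancel, NormedSpace.exp_zero]
    rw [← mul_apply_eq_comp, this, one_apply_eq_self]
  set h : ℝ → E := fun s => S (-s) (A (G s)) with hh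
  have hhc : ContinuousOn h (Ici 0) :=
    (hSc.comp continuous_neg).continuousOn.clm_apply (A.continuous.comp_continuousOn hGc)
  set w : ℝ → E := fun t => S t (0 + ∫ s in (0 : ℝ)..t, h s) with hw
  have hwd : ∀ t ≥ 0, HasDerivWithinAt w (A (G t + w t)) (Ici 0) t := fun t ht => by
    have := (hSd t).hasDerivWithinAt.clm_apply (hasDerivWithinAt_primitive hhc 0 ht)
    convert this using 1
    simp only [hh, hw, hSS, mul_apply_eq_comp, map_add]
    abel
  have hwc : ContinuousOn w (Ici 0) := fun t ht => (hwd t ht).continuousWithinAt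
  refine ⟨fun t => G t + w t, hGc.add hwc, fun t ht => ?_⟩
  have := eq_add_integral_of_hasDerivWithinAt hwd (A.continuous.comp_continuousOn (hGc.add hwc)) ht
  simp only [this]
  have h0 : w 0 = 0 := by simp [hw]
  simp only [hG, h0]
  abel

end Time

/-! ### The weighted measure -/

theorem ae_weightedMeasure_iff {a : ℝ} {p : ℝ → Prop} :
    (∀ᵐ x ∂(weightedMeasure a), p x) ↔ ∀ᵐ x ∂(volume.restrict (Ioi 0)), p x := by
  rw [weightedMeasure, ae_withDensity_iff' (by fun_prop)]
  simp [Real.exp_pos]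

theorem lintegral_weightedMeasure (a : ℝ) {g : ℝ → ℝ≥0∞} (hg : Measurable g) :
    ∫⁻ x, g x ∂(weightedMeasure a)
      = ∫⁻ x in Ioi 0, ENNReal.ofReal (Real.exp (-2 * a * x)) * g x :=
  lintegral_withDensity_eq_lintegral_mul _ (by fun_prop) hg

theorem L2w.ext_Ioi {a : ℝ} {w v : L2w a} (h : ∀ᵐ x ∂(volume.restrict (Ioi 0)), w x = v x) :
    w = v := Lp.ext (ae_weightedMeasure_iff.2 h)

theorem L2w.coeFn_add_Ioi {a : ℝ} (w v : L2w a) :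
    ∀ᵐ x ∂(volume.restrict (Ioi 0)), (w + v) x = w x + v x :=
  ae_weightedMeasure_iff.1 (Lp.coeFn_add w v)

theorem L2w.coeFn_sub_Ioi {a : ℝ} (w v : L2w a) :
    ∀ᵐ x ∂(volume.restrict (Ioi 0)), (w - v) x = w x - v x :=
  ae_weightedMeasure_iff.1 (Lp.coeFn_sub w v)

theorem L2w.coeFn_smul_Ioi {a : ℝ} (c : ℝ) (w : L2w a) :
    ∀ᵐ x ∂(volume.restrict (Ioi 0)), (c • w) x = c * w x :=
  ae_weightedMeasure_iff.1 (Lp.coeFn_smul c w)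

theorem L2w.locallyIntegrableOn {a : ℝ} (w : L2w a) : LocallyIntegrableOn w (Ici 0) := by
  have h1 : LocallyIntegrable w (weightedMeasure a) := (Lp.memLp w).locallyIntegrable (by simp)
  generalize (w : ℝ → ℝ) = g at h1 ⊢
  have h2 : LocallyIntegrable g (volume.restrict (Ioi 0)) := by
    rw [locallyIntegrable_iff]
    intro K hK
    have h3 := h1.integrableOn_isCompact hK
    rw [IntegrableOn, weightedMeasure, restrict_withDensity hK.measurableSet,
      integrable_withDensity_iff_integrable_smul' (by fun_prop) (by simp)] at h3
    -- On a compact set the weight is undone by the bounded factor e^{2ax}.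
    have h4 := IntegrableOn.continuousOn_smul (K := K) (μ := volume.restrict (Ioi 0))
      (f := fun x => Real.exp (2 * a * x)) h3 (by fun_prop) hK
    refine h4.congr (Eventually.of_forall fun x => ?_)
    simp only [smul_eq_mul, ENNReal.toReal_ofReal (Real.exp_pos _).le]
    rw [← mul_assoc, ← Real.exp_add]
    simp
  rwa [locallyIntegrableOn_iff_locallyIntegrable_restrict isClosed_Ici,
    ← restrict_Ioi_eq_restrict_Ici]

theorem isFiniteMeasure_weightedMeasure {a : ℝ} (ha : 0 < a) :
    IsFiniteMeasure (weightedMeasure a) := by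
  have : Integrable (fun x : ℝ => Real.exp (-2 * a * x)) (volume.restrict (Ioi 0)) :=
    integrableOn_exp_mul_Ioi (by linarith) 0
  exact isFiniteMeasure_withDensity_ofReal this.2

theorem memLp_of_bounded {a : ℝ} (ha : 0 < a) {k : ℝ → ℝ} (hk : Continuous k) {C : ℝ}
    (hC : ∀ x, |k x| ≤ C) : MemLp k 2 (weightedMeasure a) := by
  have := isFiniteMeasure_weightedMeasure ha
  exact MemLp.of_bound hk.aestronglyMeasurable C (Eventually.of_forall hC)

/-! ### Weak derivatives in the weighted space -/

theorem L2w.hasWeakDeriv_add {a : ℝ} {w w' v v' : L2w a} (h : HasWeakDeriv w w')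
    (h' : HasWeakDeriv v v') : HasWeakDeriv (w + v : L2w a) (w' + v' : L2w a) := by
  obtain ⟨I, hI⟩ := hasWeakDeriv_iff a
  rw [hI] at h h' ⊢
  intro L hL
  rw [← Prod.mk_add_mk, map_add, h L hL, h' L hL, add_zero]

theorem L2w.hasWeakDeriv_smul {a : ℝ} {w w' : L2w a} (c : ℝ) (h : HasWeakDeriv w w') :
    HasWeakDeriv (c • w : L2w a) (c • w' : L2w a) := by
  obtain ⟨I, hI⟩ := hasWeakDeriv_iff a
  rw [hI] at h ⊢
  intro L hL
  rw [← Prod.smul_mk, map_smul, h L hL, smul_zero]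

theorem L2w.hasWeakDeriv_sub {a : ℝ} {w w' v v' : L2w a} (h : HasWeakDeriv w w')
    (h' : HasWeakDeriv v v') : HasWeakDeriv (w - v : L2w a) (w' - v' : L2w a) := by
  have := L2w.hasWeakDeriv_add h (L2w.hasWeakDeriv_smul (-1) h')
  simpa [sub_eq_add_neg] using this

theorem L2w.hasWeakDeriv_unique {a : ℝ} {w v v' : L2w a} (h : HasWeakDeriv w v)
    (h' : HasWeakDeriv w v') : v = v' := by
  have h0 := L2w.hasWeakDeriv_sub h h'
  rw [sub_self] at h0
  have := ae_eq_zero_of_hasWeakDeriv (L2w.locallyIntegrableOn (v - v'))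
    (ae_weightedMeasure_iff.1 (Lp.coeFn_zero ℝ 2 (weightedMeasure a))) h0
  refine L2w.ext_Ioi ?_
  filter_upwards [this, L2w.coeFn_sub_Ioi v v'] with x h1 h2
  linarith

/-! ### Causal convolution on the weighted space -/

theorem lintegral_mul_sq_le {α : Type*} [MeasurableSpace α] {ν : Measure α} {f g : α → ℝ≥0∞}
    (hf : AEMeasurable f ν) (hg : AEMeasurable g ν) :
    (∫⁻ x, f x * g x ∂ν) ^ 2 ≤ (∫⁻ x, f x ^ 2 ∂ν) * ∫⁻ x, g x ^ 2 ∂ν := by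
  have h := ENNReal.lintegral_mul_le_Lp_mul_Lq ν Real.HolderConjugate.two_two hf hg
  simp only [Pi.mul_apply, ENNReal.rpow_two] at h
  calc _ ≤ _ := pow_le_pow_left' h 2
    _ = _ := by
      rw [mul_pow, ← ENNReal.rpow_two, ← ENNReal.rpow_two, ← ENNReal.rpow_mul,
        ← ENNReal.rpow_mul]
      norm_num

theorem lintegral_exp_Ioi {a : ℝ} (ha : 0 < a) (y : ℝ) :
    ∫⁻ x in Ioi y, ENNReal.ofReal (Real.exp (-a * x)) = ENNReal.ofReal (Real.exp (-a * y) / a) := by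
  rw [← ofReal_integral_eq_lintegral_ofReal (integrableOn_exp_mul_Ioi (by linarith) y)
    (Eventually.of_forall fun x => (Real.exp_pos _).le), integral_exp_mul_Ioi (by linarith),
    neg_div_neg_eq]

theorem lintegral_exp_Ioc_le {a : ℝ} (ha : 0 < a) (x : ℝ) :
    ∫⁻ y in Ioc 0 x, ENNReal.ofReal (Real.exp (a * y)) ≤ ENNReal.ofReal (Real.exp (a * x) / a) := by
  refine (lintegral_mono_set Ioc_subset_Iic_self).trans_eq ?_
  rw [← ofReal_integral_eq_lintegral_ofReal (integrableOn_exp_mul_Iic ha x)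
    (Eventually.of_forall fun x => (Real.exp_pos _).le), integral_exp_mul_Iic ha]

/-- Cauchy–Schwarz for g = e^{ay/2} · (e^{-ay/2} g): the first factor contributes at most e^{ax}/a,
which uses half of the weight e^{-2ax}. -/
theorem weighted_sq_primitive_le {a : ℝ} (ha : 0 < a) {g : ℝ → ℝ≥0∞} (hg : Measurable g) (x : ℝ) :
    ENNReal.ofReal (Real.exp (-2 * a * x)) * (∫⁻ y in Ioc 0 x, g y) ^ 2
      ≤ ENNReal.ofReal (1 / a) * (ENNReal.ofReal (Real.exp (-a * x)) *
        ∫⁻ y in Ioc 0 x, ENNReal.ofReal (Real.exp (-a * y)) * g y ^ 2) := by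
  have h1 := lintegral_mul_sq_le (ν := volume.restrict (Ioc 0 x))
    (f := fun y => ENNReal.ofReal (Real.exp (a / 2 * y)))
    (g := fun y => ENNReal.ofReal (Real.exp (-a / 2 * y)) * g y) (by fun_prop) (by fun_prop)
  have e1 : ∀ y, ENNReal.ofReal (Real.exp (a / 2 * y)) *
      (ENNReal.ofReal (Real.exp (-a / 2 * y)) * g y) = g y := fun y => by
    rw [← mul_assoc, ← ENNReal.ofReal_mul (Real.exp_pos _).le, ← Real.exp_add,
      show a / 2 * y + -a / 2 * y = 0 by ring]
    simp
  have e2 : ∀ c y : ℝ, ENNReal.ofReal (Real.exp (c / 2 * y)) ^ 2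
      = ENNReal.ofReal (Real.exp (c * y)) := fun c y => by
    rw [← ENNReal.ofReal_pow (Real.exp_pos _).le, ← Real.exp_nat_mul]
    congr 2
    push_cast
    ring
  simp only [e1, mul_pow, e2] at h1
  calc _ ≤ ENNReal.ofReal (Real.exp (-2 * a * x)) * (ENNReal.ofReal (Real.exp (a * x) / a) *
        ∫⁻ y in Ioc 0 x, ENNReal.ofReal (Real.exp (-a * y)) * g y ^ 2) := by
        gcongr
        exact h1.trans (by gcongr; exact lintegral_exp_Ioc_le ha x)
    _ = _ := by
        rw [← mul_assoc, ← mul_assoc, ← ENNReal.ofReal_mul (Real.exp_pos _).le,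
          ← ENNReal.ofReal_mul (by positivity)]
        congr 2
        rw [mul_div_assoc', ← Real.exp_add, show -2 * a * x + a * x = -a * x by ring]
        ring

/-- Tonelli, and the integral of e^{-ax} over x > y equals e^{-ay}/a. -/
theorem lintegral_weighted_primitive {a : ℝ} (ha : 0 < a) {h : ℝ → ℝ≥0∞} (hh : Measurable h) :
    ∫⁻ x in Ioi 0, ENNReal.ofReal (Real.exp (-a * x)) * ∫⁻ y in Ioc 0 x, h y
      = ENNReal.ofReal (1 / a) *
        ∫⁻ y in Ioi 0, ENNReal.ofReal (Real.exp (-a * y)) * h y := by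
  have hm : Measurable (Function.uncurry fun x y : ℝ => (Ici y).indicator
      (fun x => ENNReal.ofReal (Real.exp (-a * x)) * h y) x) := by
    have : (Function.uncurry fun x y : ℝ => (Ici y).indicator
        (fun x => ENNReal.ofReal (Real.exp (-a * x)) * h y) x)
        = {p : ℝ × ℝ | p.2 ≤ p.1}.indicator
          (fun p => ENNReal.ofReal (Real.exp (-a * p.1)) * h p.2) := by
      ext ⟨x, y⟩
      simp [indicator, Function.uncurry]
    rw [this]
    exact Measurable.indicator (by fun_prop) (measurableSet_le measurable_snd measurable_fst)
  have h1 : ∀ x, ENNReal.ofReal (Real.exp (-a * x)) * ∫⁻ y in Ioc 0 x, h y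
      = ∫⁻ y in Ioi 0, (Ici y).indicator
        (fun x => ENNReal.ofReal (Real.exp (-a * x)) * h y) x := fun x => by
    rw [← lintegral_const_mul _ hh, ← Ioi_inter_Iic, inter_comm,
      ← Measure.restrict_restrict measurableSet_Iic, ← lintegral_indicator measurableSet_Iic]
    simp [indicator]
  simp only [h1]
  rw [lintegral_lintegral_swap hm.aemeasurable, ← lintegral_const_mul _ (by fun_prop)]
  refine setLIntegral_congr_fun measurableSet_Ioi fun y hy => ?_
  rw [lintegral_indicator measurableSet_Ici, Measure.restrict_restrict measurableSet_Ici,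
    inter_eq_left.2 (Ici_subset_Ioi.2 hy), ← restrict_Ioi_eq_restrict_Ici,
    lintegral_mul_const _ (by fun_prop), lintegral_exp_Ioi ha, ← mul_assoc,
    ← ENNReal.ofReal_mul (by positivity)]
  congr 2
  ring

/-- One factor 1/a comes from Cauchy–Schwarz and one from Tonelli, so taking primitives has norm at
most 1/a on L²_a. -/
theorem weighted_hardy {a : ℝ} (ha : 0 < a) {g : ℝ → ℝ≥0∞} (hg : Measurable g) :
    ∫⁻ x in Ioi 0, ENNReal.ofReal (Real.exp (-2 * a * x)) * (∫⁻ y in Ioc 0 x, g y) ^ 2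
      ≤ ENNReal.ofReal (1 / a) ^ 2 *
        ∫⁻ x in Ioi 0, ENNReal.ofReal (Real.exp (-2 * a * x)) * g x ^ 2 := by
  refine (lintegral_mono fun x => weighted_sq_primitive_le ha hg x).trans_eq ?_
  rw [lintegral_const_mul' _ _ ENNReal.ofReal_ne_top, lintegral_weighted_primitive ha (by fun_prop),
    ← mul_assoc, ← sq]
  congr 1
  refine lintegral_congr fun x => ?_
  rw [← mul_assoc, ← ENNReal.ofReal_mul (Real.exp_pos _).le, ← Real.exp_add]
  congr 3
  ring

theorem enorm_causalConv_le {k g : ℝ → ℝ} {C : ℝ} (hC : ∀ x, |k x| ≤ C) {x : ℝ} (hx : 0 ≤ x) :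
    ‖causalConv k g x‖ₑ ≤ ENNReal.ofReal C * ∫⁻ y in Ioc 0 x, ‖g y‖ₑ := by
  rw [causalConv, intervalIntegral.integral_of_le hx]
  refine (enorm_integral_le_lintegral_enorm _).trans ?_
  rw [← lintegral_const_mul' _ _ ENNReal.ofReal_ne_top]
  refine lintegral_mono fun y => ?_
  rw [enorm_mul]
  gcongr
  rw [Real.enorm_eq_ofReal_abs]
  exact ENNReal.ofReal_le_ofReal (hC _)

theorem aestronglyMeasurable_causalConv {a : ℝ} {k g : ℝ → ℝ} (hk : Continuous k)
    (hg : StronglyMeasurable g) : AEStronglyMeasurable (causalConv k g) (weightedMeasure a) := by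
  have hm : StronglyMeasurable (Function.uncurry fun x y : ℝ => (Ici y).indicator
      (fun x => k (x - y) * g y) x) := by
    have : (Function.uncurry fun x y : ℝ => (Ici y).indicator (fun x => k (x - y) * g y) x)
        = {p : ℝ × ℝ | p.2 ≤ p.1}.indicator (fun p => k (p.1 - p.2) * g p.2) := by
      ext ⟨x, y⟩
      simp [indicator, Function.uncurry]
    rw [this]
    refine StronglyMeasurable.indicator ?_ (measurableSet_le measurable_snd measurable_fst)
    exact (hk.comp (by fun_prop : Continuous fun p : ℝ × ℝ => p.1 - p.2)).stronglyMeasurable.mul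
      (hg.comp_measurable measurable_snd)
  refine ⟨_, hm.integral_prod_right (ν := volume.restrict (Ioi 0)), ae_weightedMeasure_iff.2 ?_⟩
  filter_upwards [ae_restrict_mem measurableSet_Ioi] with x hx
  rw [causalConv, intervalIntegral.integral_of_le (le_of_lt hx), ← Ioi_inter_Iic, inter_comm,
    ← Measure.restrict_restrict measurableSet_Iic, ← integral_indicator measurableSet_Iic]
  simp [indicator]

/-- |k *ₓ g| is at most C times the primitive of |g|. Only a bound on the kernel is needed, not its
integrability. -/
theorem eLpNorm_causalConv_le {a : ℝ} (ha : 0 < a) {k g : ℝ → ℝ} {C : ℝ}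
    (hC : ∀ x, |k x| ≤ C) (hg : StronglyMeasurable g) :
    eLpNorm (causalConv k g) 2 (weightedMeasure a)
      ≤ ENNReal.ofReal (C / a) * eLpNorm g 2 (weightedMeasure a) := by
  have e : ∀ u : ℝ → ℝ, eLpNorm u 2 (weightedMeasure a) ^ 2
      = ∫⁻ x, ‖u x‖ₑ ^ 2 ∂(weightedMeasure a) := fun u => by
    have := eLpNorm_nnreal_pow_eq_lintegral (f := u) (μ := weightedMeasure a) (p := 2) two_ne_zero
    simpa using this
  have hC0 : 0 ≤ C := (abs_nonneg _).trans (hC 0)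
  rw [← ENNReal.pow_le_pow_left_iff two_ne_zero, mul_pow, e, e,
    lintegral_weightedMeasure a (hg.measurable.enorm.pow_const 2)]
  have hm := weighted_hardy ha hg.measurable.enorm
  have hm2 : Measurable fun x : ℝ => ENNReal.ofReal C * ∫⁻ y in Ioc 0 x, ‖g y‖ₑ := by
    refine Measurable.const_mul (Monotone.measurable fun x x' h => ?_) _
    exact lintegral_mono_set (Ioc_subset_Ioc_right h)
  calc ∫⁻ x, ‖causalConv k g x‖ₑ ^ 2 ∂(weightedMeasure a)
      ≤ ∫⁻ x, (ENNReal.ofReal C * ∫⁻ y in Ioc 0 x, ‖g y‖ₑ) ^ 2 ∂(weightedMeasure a) := by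
        refine lintegral_mono_ae (ae_weightedMeasure_iff.2 ?_)
        filter_upwards [ae_restrict_mem measurableSet_Ioi] with x hx
        gcongr
        exact enorm_causalConv_le hC (le_of_lt hx)
    _ = ENNReal.ofReal C ^ 2 * ∫⁻ x in Ioi 0, ENNReal.ofReal (Real.exp (-2 * a * x)) *
          (∫⁻ y in Ioc 0 x, ‖g y‖ₑ) ^ 2 := by
        rw [lintegral_weightedMeasure a (hm2.pow_const 2),
          ← lintegral_const_mul' _ _ (by finiteness)]
        refine lintegral_congr fun x => ?_
        ring
    _ ≤ _ := by
        refine (mul_le_mul_right hm _).trans_eq ?_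
        rw [← mul_assoc, ← mul_pow, ← ENNReal.ofReal_mul hC0, mul_one_div]

theorem intervalIntegrable_causalConv {k g : ℝ → ℝ} (hk : Continuous k)
    (hg : LocallyIntegrableOn g (Ici 0)) {x : ℝ} (hx : 0 ≤ x) :
    IntervalIntegrable (fun y => k (x - y) * g y) volume 0 x :=
  (intervalIntegrable_of_locallyIntegrableOn hg le_rfl hx).continuousOn_mul (by fun_prop)

theorem causalConv_congr {k g g' : ℝ → ℝ} (h : ∀ᵐ x ∂(volume.restrict (Ioi 0)), g x = g' x) {x : ℝ}
    (hx : 0 ≤ x) : causalConv k g x = causalConv k g' x :=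
  intervalIntegral_congr_ae_Ioi hx (by filter_upwards [h] with y hy; rw [hy])

theorem exists_causalConv_clm {a : ℝ} (ha : 0 < a) {k : ℝ → ℝ} (hk : Continuous k) {C : ℝ}
    (hC : ∀ x, |k x| ≤ C) : ∃ T : L2w a →L[ℝ] L2w a, ∀ w : L2w a,
      ∀ᵐ x ∂(volume.restrict (Ioi 0)), T w x = causalConv k w x := by
  have hC0 : 0 ≤ C := (abs_nonneg _).trans (hC 0)
  have hle : ∀ w : L2w a, eLpNorm (causalConv k w) 2 (weightedMeasure a)
      ≤ ENNReal.ofReal (C / a) * eLpNorm w 2 (weightedMeasure a) := fun w =>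
    eLpNorm_causalConv_le ha hC (Lp.stronglyMeasurable w)
  have hmem : ∀ w : L2w a, MemLp (causalConv k w) 2 (weightedMeasure a) := fun w =>
    ⟨aestronglyMeasurable_causalConv hk (Lp.stronglyMeasurable w),
      (hle w).trans_lt (ENNReal.mul_lt_top ENNReal.ofReal_lt_top (Lp.memLp w).2)⟩
  have hcoe : ∀ w : L2w a, ∀ᵐ x ∂(volume.restrict (Ioi 0)),
      (hmem w).toLp _ x = causalConv k w x := fun w => ae_weightedMeasure_iff.1 (hmem w).coeFn_toLp
  refine ⟨LinearMap.mkContinuous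
    { toFun := fun w => (hmem w).toLp _
      map_add' := fun w v => ?_
      map_smul' := fun c w => ?_ } (C / a) fun w => ?_, hcoe⟩
  · refine L2w.ext_Ioi ?_
    filter_upwards [hcoe w, hcoe v, hcoe (w + v), L2w.coeFn_add_Ioi ((hmem w).toLp _)
      ((hmem v).toLp _), ae_restrict_mem measurableSet_Ioi] with x h1 h2 h3 h4 hx
    have hx0 : 0 ≤ x := le_of_lt hx
    rw [h3, h4, h1, h2, causalConv_congr (L2w.coeFn_add_Ioi w v) hx0, causalConv, causalConv,
      causalConv, ← intervalIntegral.integral_add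
        (intervalIntegrable_causalConv hk w.locallyIntegrableOn hx0)
        (intervalIntegrable_causalConv hk v.locallyIntegrableOn hx0)]
    simp only [mul_add]
  · refine L2w.ext_Ioi ?_
    simp only [RingHom.id_apply]
    filter_upwards [hcoe w, hcoe (c • w), L2w.coeFn_smul_Ioi c ((hmem w).toLp _),
      ae_restrict_mem measurableSet_Ioi] with x h1 h3 h4 hx
    have hx0 : 0 ≤ x := le_of_lt hx
    rw [h3, h4, h1, causalConv_congr (L2w.coeFn_smul_Ioi c w) hx0, causalConv, causalConv,
      ← intervalIntegral.integral_const_mul]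
    simp only [mul_left_comm]
  · change ‖(hmem w).toLp _‖ ≤ _
    rw [Lp.norm_toLp, Lp.norm_def, ← ENNReal.toReal_ofReal (div_nonneg hC0 ha.le),
      ← ENNReal.toReal_mul]
    exact ENNReal.toReal_mono (ENNReal.mul_ne_top ENNReal.ofReal_ne_top (Lp.memLp w).2.ne) (hle w)

/-- Integrated form of (k *ₓ g)' = k(0) g + k' *ₓ g. It yields the weak derivative of a convolution
and its zero trace. -/
theorem causalConv_eq_primitive {k k' : ℝ → ℝ} (hk : ∀ x, HasDerivAt k (k' x) x)
    (hk' : Continuous k') {g : ℝ → ℝ} (hg : LocallyIntegrableOn g (Ici 0)) {x : ℝ} (hx : 0 ≤ x) :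
    causalConv k g x = k 0 * (∫ y in (0 : ℝ)..x, g y) + ∫ z in (0 : ℝ)..x, causalConv k' g z := by
  have hi := intervalIntegrable_of_locallyIntegrableOn hg le_rfl hx
  have hkc : Continuous k := continuous_iff_continuousAt.2 fun x => (hk x).continuousAt
  have h := integral_triangle_swap (K := fun z y => k' (z - y))
    (hk'.comp (by fun_prop : Continuous fun p : ℝ × ℝ => p.1 - p.2)) hx hi
  simp only [smul_eq_mul] at h
  have h2 : ∀ y, ∫ z in y..x, k' (z - y) = k (x - y) - k 0 := fun y => by
    rw [intervalIntegral.integral_comp_sub_right (fun z => k' z),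
      intervalIntegral.integral_eq_sub_of_hasDerivAt (fun z _ => hk z)
        (hk'.intervalIntegrable _ _), sub_self]
  simp only [h2, sub_mul] at h
  rw [intervalIntegral.integral_sub (intervalIntegrable_causalConv hkc hg hx) (hi.const_mul _),
    intervalIntegral.integral_const_mul] at h
  simp only [causalConv] at h ⊢
  linarith

/-- With u = c + ∫ g this reads k *ₓ u' = k(0) u + k' *ₓ u - u(0) k, the identity that turns the
equation into an ODE. -/
theorem causalConv_integration_by_parts {k k' : ℝ → ℝ} (hk : ∀ x, HasDerivAt k (k' x) x)
    (hk' : Continuous k') {g : ℝ → ℝ} (hg : LocallyIntegrableOn g (Ici 0)) (c : ℝ) {x : ℝ}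
    (hx : 0 ≤ x) :
    causalConv k g x = k 0 * (c + ∫ y in (0 : ℝ)..x, g y)
      + causalConv k' (fun y => c + ∫ z in (0 : ℝ)..y, g z) x - k x * c := by
  have hi := intervalIntegrable_of_locallyIntegrableOn hg le_rfl hx
  have hkc : Continuous k := continuous_iff_continuousAt.2 fun x => (hk x).continuousAt
  have h := integral_triangle_swap (K := fun y _ => k' (x - y))
    (hk'.comp (by fun_prop : Continuous fun p : ℝ × ℝ => x - p.1)) hx hi
  have h2 : ∀ y, ∫ z in y..x, k' (x - z) = k (x - y) - k 0 := fun y => by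
    rw [intervalIntegral.integral_comp_sub_left (fun z => k' z),
      intervalIntegral.integral_eq_sub_of_hasDerivAt (fun z _ => hk z)
        (hk'.intervalIntegrable _ _), sub_self]
  simp only [smul_eq_mul, h2, sub_mul, intervalIntegral.integral_const_mul] at h
  rw [intervalIntegral.integral_sub (intervalIntegrable_causalConv hkc hg hx) (hi.const_mul _),
    intervalIntegral.integral_const_mul] at h
  have hP : ContinuousOn (fun y => ∫ z in (0 : ℝ)..y, g z) (Ici 0) := continuousOn_primitive hg
  have h3 : causalConv k' (fun y => c + ∫ z in (0 : ℝ)..y, g z) x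
      = (k x - k 0) * c + ∫ y in (0 : ℝ)..x, k' (x - y) * ∫ z in (0 : ℝ)..y, g z := by
    simp only [causalConv, mul_add]
    rw [intervalIntegral.integral_add
      (Continuous.intervalIntegrable (by fun_prop) _ _)
      (intervalIntegrable_causalConv hk' hP.locallyIntegrableOn_Ici hx),
      intervalIntegral.integral_mul_const, h2, sub_zero]
  rw [h3, h]
  simp only [causalConv]
  ring

/-! ### The derivatives of the Bessel kernel -/

/-- The derivative of order `m` of the Bessel function `J_0`. -/
def besselDeriv (m : ℕ) (t : ℝ) : ℝ :=
  (1 / Real.pi) * ∫ θ in (0 : ℝ)..Real.pi,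
    Real.sin θ ^ m * Real.cos (t * Real.sin θ + m * (Real.pi / 2))

theorem besselDeriv_zero : besselDeriv 0 = besselJ 0 := by
  ext t
  simp [besselDeriv, besselJ]

theorem abs_besselDeriv_le (m : ℕ) (t : ℝ) : |besselDeriv m t| ≤ 1 := by
  have h : ‖∫ θ in (0 : ℝ)..Real.pi,
      Real.sin θ ^ m * Real.cos (t * Real.sin θ + m * (Real.pi / 2))‖ ≤ 1 * |Real.pi - 0| := by
    refine intervalIntegral.norm_integral_le_of_norm_le_const fun θ _ => ?_
    rw [norm_mul, norm_pow, Real.norm_eq_abs, Real.norm_eq_abs]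
    exact mul_le_one₀ (pow_le_one₀ (abs_nonneg _) (Real.abs_sin_le_one _)) (abs_nonneg _)
      (Real.abs_cos_le_one _)
  rw [sub_zero, one_mul, abs_of_pos Real.pi_pos, Real.norm_eq_abs] at h
  rw [besselDeriv, abs_mul, abs_of_pos (by positivity), one_div, inv_mul_le_iff₀ Real.pi_pos,
    mul_one]
  exact h

/-- Differentiating the cosine in `t` produces a factor sin θ and a phase shift π/2; the integrands
are dominated by 1. -/
theorem hasDerivAt_besselDeriv (m : ℕ) (t : ℝ) :
    HasDerivAt (besselDeriv m) (besselDeriv (m + 1) t) t := by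
  refine HasDerivAt.const_mul _ ?_
  refine (intervalIntegral.hasDerivAt_integral_of_dominated_loc_of_deriv_le (bound := fun _ => (1 : ℝ))
    (F := fun (s θ : ℝ) => Real.sin θ ^ m * Real.cos (s * Real.sin θ + m * (Real.pi / 2)))
    (F' := fun (s θ : ℝ) =>
      Real.sin θ ^ (m + 1) * Real.cos (s * Real.sin θ + ((m + 1 : ℕ) : ℝ) * (Real.pi / 2)))
    (s := univ) univ_mem (Eventually.of_forall fun s => ?_) ?_ ?_
    (Eventually.of_forall fun θ _ s _ => ?_) ?_ (Eventually.of_forall fun θ _ s _ => ?_)).2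
  · exact Continuous.aestronglyMeasurable (by fun_prop)
  · exact Continuous.intervalIntegrable (by fun_prop) _ _
  · exact Continuous.aestronglyMeasurable (by fun_prop)
  · rw [norm_mul, norm_pow, Real.norm_eq_abs, Real.norm_eq_abs]
    exact mul_le_one₀ (pow_le_one₀ (abs_nonneg _) (Real.abs_sin_le_one _)) (abs_nonneg _)
      (Real.abs_cos_le_one _)
  · exact intervalIntegrable_const
  · have h := (((hasDerivAt_id s).mul_const (Real.sin θ)).add_const (m * (Real.pi / 2))).cos.const_mul
      (Real.sin θ ^ m)
    refine h.congr_deriv ?_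
    have : s * Real.sin θ + ((m + 1 : ℕ) : ℝ) * (Real.pi / 2)
        = (id s * Real.sin θ + m * (Real.pi / 2)) + Real.pi / 2 := by
      push_cast
      simp only [id]
      ring
    rw [this, Real.cos_add_pi_div_two]
    ring

/-- The derivative of order `m` of the kernel `𝒦⁰_μ`. -/
def kernelDeriv (μ : ℝ) (m : ℕ) (x : ℝ) : ℝ :=
  (1 / kappa μ) ^ (m + 1) * besselDeriv m (x / kappa μ)

/-- `k` is the sequence of the successive derivatives of a function, all of them bounded. -/
structure IsDerivSeq (k : ℕ → ℝ → ℝ) : Prop where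
  hasDerivAt : ∀ m x, HasDerivAt (k m) (k (m + 1) x) x
  bounded : ∀ m, ∃ C : ℝ, ∀ x, |k m x| ≤ C

theorem IsDerivSeq.continuous {k : ℕ → ℝ → ℝ} (hk : IsDerivSeq k) (m : ℕ) : Continuous (k m) :=
  continuous_iff_continuousAt.2 fun x => (hk.hasDerivAt m x).continuousAt

theorem kernelDeriv_zero (μ : ℝ) : kernelDeriv μ 0 = besselKernel μ := by
  ext x
  simp [kernelDeriv, besselKernel, besselDeriv_zero]

theorem isDerivSeq_kernelDeriv (μ : ℝ) : IsDerivSeq (kernelDeriv μ) where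
  hasDerivAt m x := by
    have h := ((hasDerivAt_besselDeriv m (x / kappa μ)).comp x
      ((hasDerivAt_id x).div_const (kappa μ))).const_mul ((1 / kappa μ) ^ (m + 1))
    refine h.congr_deriv ?_
    simp only [kernelDeriv]
    ring
  bounded m := by
    refine ⟨|(1 / kappa μ) ^ (m + 1)|, fun x => ?_⟩
    rw [kernelDeriv, abs_mul]
    exact mul_le_of_le_one_right (abs_nonneg _) (abs_besselDeriv_le _ _)

/-! ### Weighted Sobolev spaces -/

namespace Hw

variable {a : ℝ} {n : ℕ}

/-- The weak derivative of order `i`, and `0` for `i > n`. -/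
def comp (i : ℕ) : Hw a n →L[ℝ] L2w a :=
  if h : i < n + 1 then (ContinuousLinearMap.proj (⟨i, h⟩ : Fin (n + 1))).comp (Hw a n).subtypeL
  else 0

theorem comp_apply {i : ℕ} (h : i < n + 1) (w : Hw a n) : comp i w = w.1 ⟨i, h⟩ := by
  simp [comp, h]

theorem comp_zero_apply (w : Hw a n) : comp 0 w = toL2 w := comp_apply (Nat.succ_pos n) w

theorem hasWeakDeriv_comp {i : ℕ} (h : i < n) (w : Hw a n) :
    HasWeakDeriv (comp i w) (comp (i + 1) w) := by
  rw [comp_apply (by omega), comp_apply (by omega)]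
  exact w.2 ⟨i, h⟩

/-- A bounded operator into `H^n_a` from its weak derivatives. -/
def lift {X : Type*} [NormedAddCommGroup X] [NormedSpace ℝ X] (T : ℕ → X →L[ℝ] L2w a)
    (hT : ∀ i < n, ∀ x, HasWeakDeriv (T i x) (T (i + 1) x)) : X →L[ℝ] Hw a n :=
  (ContinuousLinearMap.pi fun i : Fin (n + 1) => T i).codRestrict (Hw a n) fun x i => hT i i.2 x

theorem comp_lift {X : Type*} [NormedAddCommGroup X] [NormedSpace ℝ X] {T : ℕ → X →L[ℝ] L2w a}
    (hT : ∀ i < n, ∀ x, HasWeakDeriv (T i x) (T (i + 1) x)) {i : ℕ} (h : i < n + 1) (x : X) :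
    comp i (lift T hT x) = T i x := comp_apply h _

theorem toL2_lift {X : Type*} [NormedAddCommGroup X] [NormedSpace ℝ X] {T : ℕ → X →L[ℝ] L2w a}
    (hT : ∀ i < n, ∀ x, HasWeakDeriv (T i x) (T (i + 1) x)) (x : X) :
    toL2 (lift T hT x) = T 0 x := rfl

/-- Weak derivatives are unique, so the zeroth component determines all others. Identities in H^n_a
are thereby checked in L²_a. -/
theorem toL2_injective : Function.Injective (toL2 : Hw a n → L2w a) := by
  intro w v h
  have key : ∀ i < n + 1, comp i w = comp i v := by
    intro i
    induction i with
    | zero => intro _; rw [comp_zero_apply, comp_zero_apply, h]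
    | succ i ih =>
      intro hi
      have h1 := hasWeakDeriv_comp (i := i) (by omega) w
      rw [ih (by omega)] at h1
      exact L2w.hasWeakDeriv_unique h1 (hasWeakDeriv_comp (by omega) v)
  refine Subtype.ext (funext fun i => ?_)
  rw [← comp_apply i.2, ← comp_apply i.2, key i i.2]

/-- The weak derivative of order `s`, as an operator `H^n_a → H^m_a`. -/
def shift (s : ℕ) {m : ℕ} (h : m + s ≤ n) : Hw a n →L[ℝ] Hw a m :=
  lift (fun i => comp (i + s)) fun i hi w => by
    have := hasWeakDeriv_comp (i := i + s) (by omega) w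
    rwa [add_right_comm] at this

theorem toL2_shift {s m : ℕ} (h : m + s ≤ n) (w : Hw a n) : toL2 (shift s h w) = comp s w := by
  rw [shift, toL2_lift, zero_add]

theorem comp_shift {s m i : ℕ} (h : m + s ≤ n) (hi : i < m + 1) (w : Hw a n) :
    comp i (shift s h w) = comp (i + s) w := by
  rw [shift, comp_lift _ hi]

end Hw

/-! ### Convolution operators on the weighted Sobolev spaces -/

section Convolution

variable {a : ℝ} {n : ℕ} {k : ℕ → ℝ → ℝ}

theorem exists_conv_clm (ha : 0 < a) (hk : IsDerivSeq k) (m : ℕ) :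
    ∃ T : L2w a →L[ℝ] L2w a, ∀ w : L2w a,
      ∀ᵐ x ∂(volume.restrict (Ioi 0)), T w x = causalConv (k m) w x :=
  exists_causalConv_clm ha (hk.continuous m) (hk.bounded m).choose_spec

/-- Causal convolution with `k m` on `L²_a`. -/
def convL2 (ha : 0 < a) (hk : IsDerivSeq k) (m : ℕ) : L2w a →L[ℝ] L2w a :=
  (exists_conv_clm ha hk m).choose

theorem coeFn_convL2 (ha : 0 < a) (hk : IsDerivSeq k) (m : ℕ) (w : L2w a) :
    ∀ᵐ x ∂(volume.restrict (Ioi 0)), convL2 ha hk m w x = causalConv (k m) w x :=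
  (exists_conv_clm ha hk m).choose_spec w

theorem convL2_ae_eq_primitive (ha : 0 < a) (hk : IsDerivSeq k) (m : ℕ) (w : L2w a) :
    ∀ᵐ x ∂(volume.restrict (Ioi 0)), convL2 ha hk m w x
      = 0 + ∫ y in (0 : ℝ)..x, (k m 0 • w + convL2 ha hk (m + 1) w : L2w a) y := by
  filter_upwards [coeFn_convL2 ha hk m w, ae_restrict_mem measurableSet_Ioi] with x h1 hx
  have hx0 : 0 ≤ x := le_of_lt hx
  have i1 := intervalIntegrable_of_locallyIntegrableOn w.locallyIntegrableOn le_rfl hx0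
  have i2 := intervalIntegrable_of_locallyIntegrableOn
    (convL2 ha hk (m + 1) w).locallyIntegrableOn le_rfl hx0
  have h2 : ∀ᵐ y ∂(volume.restrict (Ioi 0)), (k m 0 • w + convL2 ha hk (m + 1) w : L2w a) y
      = k m 0 * w y + convL2 ha hk (m + 1) w y := by
    filter_upwards [L2w.coeFn_add_Ioi (k m 0 • w) (convL2 ha hk (m + 1) w),
      L2w.coeFn_smul_Ioi (k m 0) w] with y h3 h4
    rw [h3, h4]
  rw [h1, causalConv_eq_primitive (hk.hasDerivAt m) (hk.continuous _) w.locallyIntegrableOn hx0,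
    intervalIntegral_congr_ae_Ioi hx0 h2, intervalIntegral.integral_add (i1.const_mul _) i2,
    intervalIntegral.integral_const_mul, zero_add,
    intervalIntegral_congr_ae_Ioi hx0 (coeFn_convL2 ha hk (m + 1) w)]

theorem L2w.hasWeakDeriv_of_ae_eq_primitive {w v : L2w a} (c : ℝ)
    (h : ∀ᵐ x ∂(volume.restrict (Ioi 0)), w x = c + ∫ y in (0 : ℝ)..x, v y) :
    HasWeakDeriv w v :=
  (hasWeakDeriv_primitive v.locallyIntegrableOn c).congr
    (by filter_upwards [h] with x hx using hx.symm) (Eventually.of_forall fun _ => rfl)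

/-- The weak derivative of order `i` of the convolution with `k m`. -/
def convDeriv (ha : 0 < a) (hk : IsDerivSeq k) : ℕ → ℕ → (Hw a n →L[ℝ] L2w a)
  | m, 0 => (convL2 ha hk m).comp (Hw.comp 0)
  | m, i + 1 => k m 0 • Hw.comp i + convDeriv ha hk (m + 1) i

/-- Each differentiation moves the derivative onto the kernel, from `m` to `m + 1`, and leaves a
local term k_m(0) w; hence `m` is generalized in the induction. -/
theorem hasWeakDeriv_convDeriv (ha : 0 < a) (hk : IsDerivSeq k) {i : ℕ} (hi : i < n) (m : ℕ)
    (w : Hw a n) : HasWeakDeriv (convDeriv ha hk m i w) (convDeriv ha hk m (i + 1) w) := by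
  induction i generalizing m with
  | zero =>
    exact L2w.hasWeakDeriv_of_ae_eq_primitive 0 (convL2_ae_eq_primitive ha hk m (Hw.comp 0 w))
  | succ i ih =>
    exact L2w.hasWeakDeriv_add
      (L2w.hasWeakDeriv_smul (k m 0) (Hw.hasWeakDeriv_comp (by omega) w)) (ih (by omega) (m + 1))

/-- Causal convolution with `k m` on `H^n_a`. -/
def convHw (ha : 0 < a) (hk : IsDerivSeq k) (m : ℕ) : Hw a n →L[ℝ] Hw a n :=
  Hw.lift (convDeriv ha hk m) fun _ hi w => hasWeakDeriv_convDeriv ha hk hi m w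

theorem toL2_convHw (ha : 0 < a) (hk : IsDerivSeq k) (m : ℕ) (w : Hw a n) :
    toL2 (convHw ha hk m w) = convL2 ha hk m (toL2 w) := by
  rw [convHw, Hw.toL2_lift, ← Hw.comp_zero_apply]
  rfl

theorem memLp_kernel (ha : 0 < a) (hk : IsDerivSeq k) (m : ℕ) :
    MemLp (k m) 2 (weightedMeasure a) :=
  memLp_of_bounded ha (hk.continuous m) (hk.bounded m).choose_spec

theorem coeFn_toLp_kernel (ha : 0 < a) (hk : IsDerivSeq k) (m : ℕ) :
    ∀ᵐ x ∂(volume.restrict (Ioi 0)), (memLp_kernel ha hk m).toLp _ x = k m x :=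
  ae_weightedMeasure_iff.1 (memLp_kernel ha hk m).coeFn_toLp

theorem toLp_kernel_ae_eq_primitive (ha : 0 < a) (hk : IsDerivSeq k) (m : ℕ) :
    ∀ᵐ x ∂(volume.restrict (Ioi 0)), (memLp_kernel ha hk m).toLp _ x
      = k m 0 + ∫ y in (0 : ℝ)..x, (memLp_kernel ha hk (m + 1)).toLp _ y := by
  filter_upwards [coeFn_toLp_kernel ha hk m, ae_restrict_mem measurableSet_Ioi] with x h1 hx
  rw [h1, intervalIntegral_congr_ae_Ioi (le_of_lt hx) (coeFn_toLp_kernel ha hk (m + 1)),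
    intervalIntegral.integral_eq_sub_of_hasDerivAt (fun z _ => hk.hasDerivAt m z)
        ((hk.continuous _).intervalIntegrable _ _)]
  ring

/-- The kernel, as an element of `H^n_a`. -/
def kernelHw (ha : 0 < a) (hk : IsDerivSeq k) : Hw a n :=
  ⟨fun i => (memLp_kernel ha hk i).toLp _, fun i =>
    L2w.hasWeakDeriv_of_ae_eq_primitive _ (toLp_kernel_ae_eq_primitive ha hk i)⟩

theorem toL2_kernelHw (ha : 0 < a) (hk : IsDerivSeq k) :
    toL2 (kernelHw ha hk : Hw a n) = (memLp_kernel ha hk 0).toLp _ := rfl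

/-- The bounded operator `w ↦ -(k(0) w + k' *ₓ w)`, where `k = k 0`. -/
def evolOp (ha : 0 < a) (hk : IsDerivSeq k) : Hw a n →L[ℝ] Hw a n :=
  -(k 0 0 • ContinuousLinearMap.id ℝ _ + convHw ha hk 1)

theorem toL2_evolOp (ha : 0 < a) (hk : IsDerivSeq k) (w : Hw a n) :
    toL2 (evolOp ha hk w) = -(k 0 0 • toL2 w + convL2 ha hk 1 (toL2 w)) := by
  rw [← toL2_convHw]
  rfl

end Convolution

/-! ### Traces and point evaluations -/

section Trace

variable {a : ℝ}

/-- A representative continuous up to 0 must coincide with the absolutely continuous one, whose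
constant is its value at 0. -/
theorem hasTrace_iff {w v : L2w a} (h : HasWeakDeriv w v) (c : ℝ) :
    HasTrace w c ↔
      ∀ᵐ x ∂(volume.restrict (Ioi 0)), w x = c + ∫ y in (0 : ℝ)..x, v y := by
  have hP : ∀ c' : ℝ, ContinuousOn (fun x => c' + ∫ y in (0 : ℝ)..x, v y) (Ici 0) := fun c' =>
    continuousOn_const.add (continuousOn_primitive v.locallyIntegrableOn)
  constructor
  · rintro ⟨g, hg, hwg, rfl⟩
    obtain ⟨c', hc'⟩ := exists_ae_eq_primitive w.locallyIntegrableOn v.locallyIntegrableOn h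
    have : EqOn g (fun x => c' + ∫ y in (0 : ℝ)..x, v y) (Ici 0) := by
      refine eqOn_Ici_of_ae_eq ?_ hg (hP c')
      filter_upwards [hwg, hc'] with x h1 h2
      rw [← h1, h2]
    have h0 : g 0 = c' := by simpa using this self_mem_Ici
    rw [h0]
    exact hc'
  · intro hw
    exact ⟨_, hP c, hw, by simp⟩

/-- Pairing with a cut-off χ, χ(0) = 1, gives w(0) = -∫ χ' w - ∫ χ w', which is bounded in w. -/
theorem exists_trace_clm (a : ℝ) : ∃ τ : Hw a 1 →L[ℝ] ℝ, ∀ w : Hw a 1,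
    ∀ᵐ x ∂(volume.restrict (Ioi 0)),
      toL2 w x = τ w + ∫ y in (0 : ℝ)..x, Hw.comp 1 w y := by
  let χ : ContDiffBump (0 : ℝ) := ⟨1, 2, one_pos, one_lt_two⟩
  have h1 : ContDiff ℝ ∞ χ := χ.contDiff
  have h2 : HasCompactSupport χ := χ.hasCompactSupport
  have h0 : χ 0 = 1 := χ.one_of_mem_closedBall (by simp [χ.rIn_pos.le])
  obtain ⟨A, hA⟩ := exists_pairing a (deriv χ) (h1.continuous_deriv (by simp)) h2.deriv
  obtain ⟨B, hB⟩ := exists_pairing a χ h1.continuous h2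
  let τ : Hw a 1 →L[ℝ] ℝ := -(A.comp (Hw.comp 0) + B.comp (Hw.comp 1))
  refine ⟨τ, fun w => ?_⟩
  have hd := Hw.hasWeakDeriv_comp (i := 0) one_pos w
  rw [zero_add, Hw.comp_zero_apply] at hd
  obtain ⟨c, hc⟩ := exists_ae_eq_primitive (L2w.locallyIntegrableOn _)
    (L2w.locallyIntegrableOn _) hd
  have key := integral_deriv_smul_primitive (Hw.comp 1 w).locallyIntegrableOn c h1 h2
  have e : ∫ x in Ioi (0 : ℝ), deriv χ x • (c + ∫ s in (0 : ℝ)..x, Hw.comp 1 w s)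
      = A (toL2 w) := by
    rw [← hA]
    refine integral_congr_ae ?_
    filter_upwards [hc] with x hx
    rw [hx]
  rw [e, hB, h0, one_smul] at key
  have hτ : τ w = c := by
    change -(A (Hw.comp 0 w) + B (Hw.comp 1 w)) = c
    rw [Hw.comp_zero_apply, key]
    ring
  rw [hτ]
  exact hc

theorem exists_integral_clm (a x : ℝ) : ∃ L : L2w a →L[ℝ] ℝ, ∀ w : L2w a,
    ∫ s in Ioc 0 x, w s = L w := by
  -- The factor e^{2as} cancels the weight in the inner product.
  set q : ℝ → ℝ := (Ioc 0 x).indicator fun s => Real.exp (2 * a * s) with hq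
  have hm : MemLp q 2 (weightedMeasure a) := by
    rw [hq, memLp_indicator_iff_restrict measurableSet_Ioc]
    have : IsFiniteMeasure ((weightedMeasure a).restrict (Ioc 0 x)) :=
      ⟨by rw [Measure.restrict_apply_univ]; exact measure_Ioc_lt_top⟩
    refine MemLp.of_bound (Continuous.aestronglyMeasurable (by fun_prop))
      (Real.exp (|2 * a| * x)) ?_
    filter_upwards [ae_restrict_mem measurableSet_Ioc] with s hs
    rw [Real.norm_eq_abs, Real.abs_exp, Real.exp_le_exp]
    exact mul_le_mul (le_abs_self _) hs.2 hs.1.le (abs_nonneg _)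
  refine ⟨innerSL ℝ (hm.toLp _), fun w => ?_⟩
  rw [innerSL_apply_apply, L2.inner_def]
  have h1 : ∫ s, inner ℝ ((hm.toLp _ : L2w a) s) (w s) ∂(weightedMeasure a)
      = ∫ s, q s * w s ∂(weightedMeasure a) := by
    refine integral_congr_ae ?_
    filter_upwards [hm.coeFn_toLp] with s hs
    rw [hs]
    simp [mul_comm]
  have h0 : ∀ g : ℝ → ℝ, ∫ s, g s ∂(weightedMeasure a)
      = ∫ s in Ioi (0 : ℝ), (ENNReal.ofReal (Real.exp (-2 * a * s))).toReal • g s := fun g =>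
    integral_withDensity_eq_integral_toReal_smul (by fun_prop) (by simp) g
  have h2 : ∀ s, Real.exp (-2 * a * s) * Real.exp (2 * a * s) = 1 := fun s => by
    rw [← Real.exp_add]; simp
  rw [h1, h0, ← inter_eq_left.2 (Ioc_subset_Ioi_self : Ioc 0 x ⊆ Ioi 0),
    ← Measure.restrict_restrict measurableSet_Ioc, ← integral_indicator measurableSet_Ioc]
  refine integral_congr_ae (Eventually.of_forall fun s => ?_)
  simp only [smul_eq_mul, ENNReal.toReal_ofReal (Real.exp_pos _).le, hq, indicator]
  split_ifs
  · rw [← mul_assoc, h2, one_mul]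
  · simp

/-- The trace at `x = 0` on `H^1_a`. -/
def trace (a : ℝ) : Hw a 1 →L[ℝ] ℝ := (exists_trace_clm a).choose

theorem ae_eq_trace_add_primitive (w : Hw a 1) : ∀ᵐ x ∂(volume.restrict (Ioi 0)),
    toL2 w x = trace a w + ∫ y in (0 : ℝ)..x, Hw.comp 1 w y :=
  (exists_trace_clm a).choose_spec w

theorem Hw.hasWeakDeriv_toL2 {n : ℕ} (h : 0 < n) (w : Hw a n) :
    HasWeakDeriv (toL2 w) (Hw.comp 1 w) := by
  have := Hw.hasWeakDeriv_comp h w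
  rwa [Hw.comp_zero_apply] at this

theorem hasTrace_trace (w : Hw a 1) : HasTrace (toL2 w) (trace a w) :=
  (hasTrace_iff (Hw.hasWeakDeriv_toL2 one_pos w) _).2 (ae_eq_trace_add_primitive w)

theorem HasTrace.unique {w v : L2w a} (h : HasWeakDeriv w v) {c c' : ℝ} (hc : HasTrace w c)
    (hc' : HasTrace w c') : c = c' := by
  rw [hasTrace_iff h] at hc hc'
  have h0 : (volume.restrict (Ioi (0 : ℝ))) ≠ 0 := by simp
  have := ae_neBot.2 h0
  obtain ⟨x, h1, h2⟩ := (hc.and hc').exists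
  linarith

theorem trace_eq_of_hasTrace {w : Hw a 1} {c : ℝ} (h : HasTrace (toL2 w) c) : trace a w = c :=
  (hasTrace_trace w).unique (Hw.hasWeakDeriv_toL2 one_pos w) h

theorem hasTrace_convL2 {k : ℕ → ℝ → ℝ} (ha : 0 < a) (hk : IsDerivSeq k) (m : ℕ) (w : L2w a) :
    HasTrace (convL2 ha hk m w) 0 :=
  have h := convL2_ae_eq_primitive ha hk m w
  (hasTrace_iff (L2w.hasWeakDeriv_of_ae_eq_primitive 0 h) _).2 h

theorem hasTrace_kernel {k : ℕ → ℝ → ℝ} (ha : 0 < a) (hk : IsDerivSeq k) (m : ℕ) :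
    HasTrace ((memLp_kernel ha hk m).toLp _ : L2w a) (k m 0) :=
  have h := toLp_kernel_ae_eq_primitive ha hk m
  (hasTrace_iff (L2w.hasWeakDeriv_of_ae_eq_primitive _ h) _).2 h

/-- Evaluation at the point `x ≥ 0` on `H^1_a`. -/
def evalAt (a x : ℝ) : Hw a 1 →L[ℝ] ℝ :=
  trace a + (exists_integral_clm a x).choose.comp (Hw.comp 1)

theorem evalAt_apply {x : ℝ} (hx : 0 ≤ x) (w : Hw a 1) :
    evalAt a x w = trace a w + ∫ y in (0 : ℝ)..x, Hw.comp 1 w y := by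
  rw [intervalIntegral.integral_of_le hx, (exists_integral_clm a x).choose_spec]
  rfl

theorem continuousOn_evalAt (w : Hw a 1) : ContinuousOn (fun x => evalAt a x w) (Ici 0) :=
  (continuousOn_const.add (continuousOn_primitive (Hw.comp 1 w).locallyIntegrableOn)).congr
    fun _ hx => evalAt_apply hx w

theorem ae_eq_evalAt (w : Hw a 1) :
    ∀ᵐ x ∂(volume.restrict (Ioi 0)), toL2 w x = evalAt a x w := by
  filter_upwards [ae_eq_trace_add_primitive w, ae_restrict_mem measurableSet_Ioi] with x h hx
  rw [h, evalAt_apply (le_of_lt hx)]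

/-- Each w is bounded on [0, R] by continuity, so Banach–Steinhaus gives a uniform bound. -/
theorem exists_norm_evalAt_le (a R : ℝ) : ∃ C : NNReal, ∀ x ∈ Icc 0 R, ‖evalAt a x‖ ≤ C := by
  obtain ⟨C, hC⟩ := banach_steinhaus (g := fun x : Icc (0 : ℝ) R => evalAt a x) fun w => by
    obtain ⟨C, hC⟩ := isCompact_Icc.exists_bound_of_continuousOn
      ((continuousOn_evalAt w).mono (Icc_subset_Ici_self : Icc 0 R ⊆ _))
    exact ⟨C, fun x => hC x x.2⟩
  exact ⟨C.toNNReal, fun x hx => (hC ⟨x, hx⟩).trans (Real.le_coe_toNNReal C)⟩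

/-- Evaluation is continuous in x and Lipschitz in w uniformly for bounded x, hence jointly
continuous. -/
theorem continuousOn_evalAt_prod {w : ℝ → Hw a 1} (hw : ContinuousOn w (Ici 0)) :
    ContinuousOn (fun p : ℝ × ℝ => evalAt a p.2 (w p.1)) (Ici 0 ×ˢ Ici 0) := by
  rintro ⟨t, x⟩ ⟨ht, hx⟩
  obtain ⟨C, hC⟩ := exists_norm_evalAt_le a (x + 1)
  have h1 : ContinuousOn (fun p : ℝ × Hw a 1 => evalAt a p.1 p.2) (Icc 0 (x + 1) ×ˢ univ) := by
    refine continuousOn_prod_of_continuousOn_lipschitzOnWith' _ C (fun y hy => ?_) fun v _ => ?_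
    · refine LipschitzWith.lipschitzOnWith ?_
      exact (evalAt a y).lipschitz.weaken (hC y hy)
    · exact (continuousOn_evalAt v).mono Icc_subset_Ici_self
  have h2 : ContinuousOn (fun p : ℝ × ℝ => evalAt a p.2 (w p.1)) (Ici 0 ×ˢ Icc 0 (x + 1)) :=
    h1.comp (f := fun p : ℝ × ℝ => (p.2, w p.1))
      (continuousOn_snd.prodMk (hw.comp continuousOn_fst fun p hp => hp.1))
      fun p hp => ⟨hp.2, mem_univ _⟩
  refine (h2 (t, x) ⟨ht, hx, by simp⟩).mono_of_mem_nhdsWithin ?_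
  rw [nhdsWithin_prod_eq]
  refine prod_mem_prod self_mem_nhdsWithin ?_
  rw [← Ici_inter_Iic]
  exact inter_mem_nhdsWithin _ (Iic_mem_nhds (lt_add_one x))

/-- The derivative of order s + 1 still lies in H^1_a, hence is continuous, and the weak derivative
is classical. -/
theorem hasDerivWithinAt_evalAt {n s : ℕ} (h : 1 + (s + 1) ≤ n) (w : Hw a n) {x : ℝ} (hx : 0 ≤ x) :
    HasDerivWithinAt (fun x => evalAt a x (Hw.shift s (by omega) w))
      (evalAt a x (Hw.shift (s + 1) h w)) (Ici 0) x := by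
  set w₁ : Hw a 1 := Hw.shift (s + 1) h w with hw₁
  refine (hasDerivWithinAt_primitive (continuousOn_evalAt w₁)
    (trace a (Hw.shift s (by omega) w)) hx).congr_of_mem (fun y hy => ?_) hx
  rw [evalAt_apply hy]
  congr 1
  refine intervalIntegral_congr_ae_Ioi hy ?_
  have := ae_eq_evalAt w₁
  rw [hw₁, Hw.toL2_shift] at this
  rw [Hw.comp_shift _ (by norm_num), add_comm 1 s]
  exact this

end Trace

/-! ### Continuous differentiability on the quadrant -/

/-- Going from p to q through (p.1, q.2), which stays in the quadrant, the mean value inequality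
costs ε/2 on each segment. -/
theorem hasFDerivWithinAt_of_partials {U P Q : ℝ × ℝ → ℝ}
    (hP : ContinuousOn P (Ici 0 ×ˢ Ici 0)) (hQ : ContinuousOn Q (Ici 0 ×ˢ Ici 0))
    (hUt : ∀ t ≥ 0, ∀ x ≥ 0, HasDerivWithinAt (fun t => U (t, x)) (P (t, x)) (Ici 0) t)
    (hUx : ∀ t ≥ 0, ∀ x ≥ 0, HasDerivWithinAt (fun x => U (t, x)) (Q (t, x)) (Ici 0) x)
    {p : ℝ × ℝ} (hp : p ∈ Ici (0 : ℝ) ×ˢ Ici (0 : ℝ)) :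
    HasFDerivWithinAt U (P p • ContinuousLinearMap.fst ℝ ℝ ℝ + Q p • ContinuousLinearMap.snd ℝ ℝ ℝ)
      (Ici 0 ×ˢ Ici 0) p := by
  set S : Set (ℝ × ℝ) := Ici 0 ×ˢ Ici 0 with hS
  rw [hasFDerivWithinAt_iff_isLittleO, Asymptotics.isLittleO_iff]
  intro ε hε
  have hPp := Metric.continuousWithinAt_iff.1 (hP p hp) (ε / 2) (half_pos hε)
  have hQp := Metric.continuousWithinAt_iff.1 (hQ p hp) (ε / 2) (half_pos hε)
  obtain ⟨δ₁, hδ₁, h1⟩ := hPp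
  obtain ⟨δ₂, hδ₂, h2⟩ := hQp
  have hmem : S ∩ Metric.ball p (min δ₁ δ₂) ∈ 𝓝[S] p :=
    inter_mem_nhdsWithin _ (Metric.ball_mem_nhds p (lt_min hδ₁ hδ₂))
  filter_upwards [hmem] with q hq
  obtain ⟨⟨hq1, hq2⟩, hqb⟩ := hq
  have hqb' := hqb
  rw [Metric.mem_ball, Prod.dist_eq, max_lt_iff] at hqb
  set δ := min δ₁ δ₂
  have hδ : 0 < δ := lt_min hδ₁ hδ₂
  have convI : ∀ c : ℝ, Convex ℝ (Ici (0 : ℝ) ∩ Metric.ball c δ) := fun c =>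
    (convex_Ici 0).inter (convex_ball c δ)
  have b1 : ‖U (q.1, q.2) - U (p.1, q.2) - (q.1 - p.1) * P p‖ ≤ ε / 2 * ‖q.1 - p.1‖ := by
    have := (convI p.1).norm_image_sub_le_of_norm_hasDerivWithin_le
      (f := fun t => U (t, q.2) - t * P p) (f' := fun t => P (t, q.2) - 1 * P p) (C := ε / 2)
      (fun t ht => ((hUt t ht.1 q.2 hq2).mono inter_subset_left).sub
        ((hasDerivWithinAt_id t _).mul_const _)) (fun t ht => ?_)
      (x := p.1) (y := q.1) ⟨hp.1, Metric.mem_ball_self hδ⟩ ⟨hq1, hqb.1⟩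
    · rw [show U (q.1, q.2) - U (p.1, q.2) - (q.1 - p.1) * P p
        = (U (q.1, q.2) - q.1 * P p) - (U (p.1, q.2) - p.1 * P p) by ring]
      exact this
    · rw [one_mul, Real.norm_eq_abs, ← Real.dist_eq]
      refine (@h1 (t, q.2) ⟨ht.1, hq2⟩ ?_).le
      rw [Prod.dist_eq]
      exact max_lt (ht.2.trans_le (min_le_left _ _)) (hqb.2.trans_le (min_le_left _ _))
  have b2 : ‖U (p.1, q.2) - U (p.1, p.2) - (q.2 - p.2) * Q p‖ ≤ ε / 2 * ‖q.2 - p.2‖ := by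
    have := (convI p.2).norm_image_sub_le_of_norm_hasDerivWithin_le
      (f := fun x => U (p.1, x) - x * Q p) (f' := fun x => Q (p.1, x) - 1 * Q p) (C := ε / 2)
      (fun x hx => ((hUx p.1 hp.1 x hx.1).mono inter_subset_left).sub
        ((hasDerivWithinAt_id x _).mul_const _)) (fun x hx => ?_)
      (x := p.2) (y := q.2) ⟨hp.2, Metric.mem_ball_self hδ⟩ ⟨hq2, hqb.2⟩
    · rw [show U (p.1, q.2) - U (p.1, p.2) - (q.2 - p.2) * Q p
        = (U (p.1, q.2) - q.2 * Q p) - (U (p.1, p.2) - p.2 * Q p) by ring]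
      exact this
    · rw [one_mul, Real.norm_eq_abs, ← Real.dist_eq]
      refine (@h2 (p.1, x) ⟨hp.1, hx.1⟩ ?_).le
      rw [Prod.dist_eq, dist_self]
      exact max_lt hδ₂ (hx.2.trans_le (min_le_right _ _))
  have e1 : ‖q.1 - p.1‖ ≤ ‖q - p‖ := norm_fst_le (q - p)
  have e2 : ‖q.2 - p.2‖ ≤ ‖q - p‖ := norm_snd_le (q - p)
  have : U q - U p - (P p • ContinuousLinearMap.fst ℝ ℝ ℝ + Q p • ContinuousLinearMap.snd ℝ ℝ ℝ)
      (q - p) = (U (q.1, q.2) - U (p.1, q.2) - (q.1 - p.1) * P p)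
        + (U (p.1, q.2) - U (p.1, p.2) - (q.2 - p.2) * Q p) := by
    simp
    ring
  rw [this]
  refine (norm_add_le _ _).trans ?_
  nlinarith

theorem contDiffOn_succ_of_partials {U P Q : ℝ × ℝ → ℝ} {j : ℕ}
    (hP : ContDiffOn ℝ j P (Ici 0 ×ˢ Ici 0)) (hQ : ContDiffOn ℝ j Q (Ici 0 ×ˢ Ici 0))
    (hUt : ∀ t ≥ 0, ∀ x ≥ 0, HasDerivWithinAt (fun t => U (t, x)) (P (t, x)) (Ici 0) t)
    (hUx : ∀ t ≥ 0, ∀ x ≥ 0, HasDerivWithinAt (fun x => U (t, x)) (Q (t, x)) (Ici 0) x) :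
    ContDiffOn ℝ ((j + 1 : ℕ) : WithTop ℕ∞) U (Ici 0 ×ˢ Ici 0) := by
  push_cast
  rw [contDiffOn_succ_iff_hasFDerivWithinAt_of_uniqueDiffOn
    ((uniqueDiffOn_Ici 0).prod (uniqueDiffOn_Ici 0))]
  exact ⟨by simp, _, (hP.smul contDiffOn_const).add (hQ.smul contDiffOn_const), fun p hp =>
    hasFDerivWithinAt_of_partials hP.continuousOn hQ.continuousOn hUt hUx hp⟩

/-! ### Solutions of the initial boundary value problem -/

section Solution

variable {a : ℝ} {k : ℕ → ℝ → ℝ}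

theorem causalConv_weakDeriv (ha : 0 < a) (hk : IsDerivSeq k) {w v : L2w a} {c : ℝ}
    (h : HasWeakDeriv w v) (hc : HasTrace w c) : ∀ᵐ x ∂(volume.restrict (Ioi 0)),
      causalConv (k 0) v x = k 0 0 * w x + convL2 ha hk 1 w x - k 0 x * c := by
  rw [hasTrace_iff h] at hc
  filter_upwards [hc, coeFn_convL2 ha hk 1 w, ae_restrict_mem measurableSet_Ioi] with x h1 h2 hx
  have hx0 : 0 ≤ x := le_of_lt hx
  rw [causalConv_integration_by_parts (hk.hasDerivAt 0) (hk.continuous 1) v.locallyIntegrableOn c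
    hx0, h2, causalConv_congr hc hx0, h1]

theorem MemX.contDiffOn {u : ℝ → L2w a} (hu : MemX a 1 u) : ContDiffOn ℝ 1 u (Ici 0) := by
  obtain ⟨U, hU, hUu⟩ := hu 1 le_rfl
  refine (((Hw.comp 0).contDiff (n := 1)).comp_contDiffOn hU).congr fun t ht => ?_
  rw [← hUu t ht, ← Hw.comp_zero_apply]
  rfl

/-- The difference w of two solutions satisfies w' = A w in L²_a with w(0) = 0. -/
theorem IsSolution.unique {μ : ℝ} (ha : 0 < a) {f : ℝ → L2w a} {ubar : ℝ → ℝ} {uin : L2w a}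
    {u v : ℝ → L2w a} (hu : MemX a 1 u) (hv : MemX a 1 v) (hsu : IsSolution μ a f ubar uin u)
    (hsv : IsSolution μ a f ubar uin v) : EqOn v u (Ici 0) := by
  have hk := isDerivSeq_kernelDeriv μ
  set A : L2w a →L[ℝ] L2w a :=
    -(kernelDeriv μ 0 0 • ContinuousLinearMap.id ℝ _ + convL2 ha hk 1) with hA
  have hw : ContDiffOn ℝ ((0 + 1 : ℕ) : WithTop ℕ∞) (fun t => v t - u t) (Ici 0) := by
    simpa using hv.contDiffOn.sub hu.contDiffOn
  obtain ⟨g, hg, hd⟩ := exists_hasDerivWithinAt_of_contDiffOn hw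
  have hgA : ∀ᵐ t ∂(volume.restrict (Ioi 0)), g t = A (v t - u t) := by
    filter_upwards [hsu.equation, hsv.equation, ae_restrict_mem measurableSet_Ioi] with t h1 h2 ht
    have ht0 : (0 : ℝ) < t := ht
    obtain ⟨ut, ux, hut, hux, hue⟩ := h1
    obtain ⟨vt, vx, hvt, hvx, hve⟩ := h2
    have hgt : g t = vt - ut :=
      ((hd t ht0.le).hasDerivAt (Ici_mem_nhds ht0)).unique (hvt.sub hut)
    have h5 : A (v t - u t)
        = -(kernelDeriv μ 0 0 • (v t - u t) + (convL2 ha hk 1 (v t) - convL2 ha hk 1 (u t))) := by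
      rw [← map_sub]
      rfl
    -- The source `f t` and the boundary term k(x) `ubar t` are common to both solutions and cancel.
    have h6 : vt - ut
        + (kernelDeriv μ 0 0 • (v t - u t) + (convL2 ha hk 1 (v t) - convL2 ha hk 1 (u t))) = 0 := by
      refine L2w.ext_Ioi ?_
      filter_upwards [hue, hve, causalConv_weakDeriv ha hk hux (hsu.boundary t ht0.le),
        causalConv_weakDeriv ha hk hvx (hsv.boundary t ht0.le),
        L2w.coeFn_add_Ioi (vt - ut) (kernelDeriv μ 0 0 • (v t - u t)
          + (convL2 ha hk 1 (v t) - convL2 ha hk 1 (u t))),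
        L2w.coeFn_add_Ioi (kernelDeriv μ 0 0 • (v t - u t))
          (convL2 ha hk 1 (v t) - convL2 ha hk 1 (u t)),
        L2w.coeFn_sub_Ioi vt ut, L2w.coeFn_sub_Ioi (v t) (u t),
        L2w.coeFn_smul_Ioi (kernelDeriv μ 0 0) (v t - u t),
        L2w.coeFn_sub_Ioi (convL2 ha hk 1 (v t)) (convL2 ha hk 1 (u t)),
        ae_weightedMeasure_iff.1 (Lp.coeFn_zero ℝ 2 (weightedMeasure a))]
        with x e1 e2 e3 e4 e5 e6 e7 e8 e9 e10 e11
      rw [e5, e6, e7, e9, e8, e10, e11]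
      rw [← kernelDeriv_zero, e3] at e1
      rw [← kernelDeriv_zero, e4] at e2
      simp only [Pi.zero_apply]
      linarith
    rw [hgt, h5]
    exact eq_neg_of_add_eq_zero_left h6
  intro t ht
  refine sub_eq_zero.1 (eq_zero_of_eq_integral A hw.continuousOn (fun s hs => ?_) ht)
  rw [← intervalIntegral_congr_ae_Ioi hs hgA,
    eq_add_integral_of_hasDerivWithinAt hd hg.continuousOn hs, hsu.initial, hsv.initial, sub_self,
    zero_add]

/-- Bootstrap: if V is C^i with i ≤ j, then so is V' = A V + h, and V is C^{i+1}. -/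
theorem contDiffOn_of_linear_ode {E : Type*} [NormedAddCommGroup E] [NormedSpace ℝ E]
    [CompleteSpace E] (A : E →L[ℝ] E) {V h : ℝ → E} {v₀ : E} {j : ℕ}
    (hV : ContinuousOn V (Ici 0)) (hh : ContDiffOn ℝ j h (Ici 0))
    (he : ∀ t ≥ 0, V t = v₀ + (∫ s in (0 : ℝ)..t, A (V s)) + ∫ s in (0 : ℝ)..t, h s) :
    ContDiffOn ℝ ((j + 1 : ℕ) : WithTop ℕ∞) V (Ici 0) ∧
      ∀ t ≥ 0, HasDerivWithinAt V (A (V t) + h t) (Ici 0) t := by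
  have hAV : ContinuousOn (fun s => A (V s)) (Ici 0) := A.continuous.comp_continuousOn hV
  have hd : ∀ t ≥ 0, HasDerivWithinAt V (A (V t) + h t) (Ici 0) t := fun t ht => by
    refine (hasDerivWithinAt_primitive (g := fun s => A (V s) + h s) (hAV.add hh.continuousOn) v₀ ht).congr_of_mem
      (fun s hs => ?_) ht
    have i1 := intervalIntegrable_of_locallyIntegrableOn hAV.locallyIntegrableOn_Ici le_rfl hs
    have i2 := intervalIntegrable_of_locallyIntegrableOn
      hh.continuousOn.locallyIntegrableOn_Ici le_rfl hs
    rw [he s hs, add_assoc, intervalIntegral.integral_add i1 i2]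
  refine ⟨?_, hd⟩
  have key : ∀ i ≤ j + 1, ContDiffOn ℝ i V (Ici 0) := by
    intro i
    induction i with
    | zero => exact fun _ => contDiffOn_zero.2 hV
    | succ i ih =>
      intro hi
      refine contDiffOn_succ_of_hasDerivWithinAt hd ?_
      refine (A.contDiff.comp_contDiffOn (ih (by omega))).add (hh.of_le ?_)
      exact_mod_cast (by omega : i ≤ j)
  exact key _ le_rfl

/-- `Hw.shift 0` is the inclusion of H^n_a in H^m_a; its commuting with A lets one solution be read
in every space. -/
theorem Hw.shift_zero_evolOp (ha : 0 < a) (hk : IsDerivSeq k) {n m : ℕ} (h : m + 0 ≤ n)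
    (w : Hw a n) : Hw.shift 0 h (evolOp ha hk w) = evolOp ha hk (Hw.shift 0 h w) := by
  apply Hw.toL2_injective
  rw [Hw.toL2_shift, Hw.comp_zero_apply, toL2_evolOp, toL2_evolOp, Hw.toL2_shift,
    Hw.comp_zero_apply]

theorem Hw.shift_zero_kernelHw (ha : 0 < a) (hk : IsDerivSeq k) {n m : ℕ} (h : m + 0 ≤ n) :
    Hw.shift 0 h (kernelHw ha hk : Hw a n) = kernelHw ha hk := by
  apply Hw.toL2_injective
  rw [Hw.toL2_shift, Hw.comp_zero_apply, toL2_kernelHw, toL2_kernelHw]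

/-- The convolution part has zero trace, so at x = 0 the operator is multiplication by -k(0). -/
theorem trace_shift_evolOp (ha : 0 < a) (hk : IsDerivSeq k) {n : ℕ} (h : 1 + 0 ≤ n) (w : Hw a n) :
    trace a (Hw.shift 0 h (evolOp ha hk w)) = -(k 0 0 * trace a (Hw.shift 0 h w)) := by
  rw [Hw.shift_zero_evolOp]
  set v : Hw a 1 := Hw.shift 0 h w
  change trace a (-(k 0 0 • v + convHw ha hk 1 v)) = _
  have : trace a (convHw ha hk 1 v) = 0 := trace_eq_of_hasTrace <| by
    rw [toL2_convHw]
    exact hasTrace_convL2 ha hk 1 _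
  rw [map_neg, map_add, map_smul, this, add_zero, smul_eq_mul]

theorem trace_kernelHw (ha : 0 < a) (hk : IsDerivSeq k) :
    trace a (kernelHw ha hk : Hw a 1) = k 0 0 :=
  trace_eq_of_hasTrace (hasTrace_kernel ha hk 0)

/-- The reduced problem: a linear differential equation in `H^{n-j}_a`. -/
theorem exists_reduced_solution (ha : 0 < a) (hk : IsDerivSeq k) {n : ℕ} {f : ℝ → L2w a}
    (hf : MemY a n f) (uin : Hw a n) {ubar : ℝ → ℝ} (hubar : ContDiffOn ℝ (n - 1 : ℕ) ubar (Ici 0)) :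
    ∃ U : ℝ → Hw a n, ContinuousOn U (Ici 0) ∧ U 0 = uin ∧
      ∀ j, 1 ≤ j → (h : j ≤ n) → ∃ F : ℝ → Hw a (n - j), ContDiffOn ℝ (j - 1 : ℕ) F (Ici 0) ∧
        (∀ᵐ t ∂(volume.restrict (Ioi 0)), toL2 (F t) = f t) ∧
        ContDiffOn ℝ j (fun t => Hw.shift 0 (Nat.sub_le n j) (U t)) (Ici 0) ∧
        ∀ t ≥ 0, HasDerivWithinAt (fun t => Hw.shift 0 (Nat.sub_le n j) (U t))
          (evolOp ha hk (Hw.shift 0 (Nat.sub_le n j) (U t)) + (F t + ubar t • kernelHw ha hk))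
          (Ici 0) t := by
  -- Membership with j = 0 makes f locally integrable in time with values in H^n_a, enough to solve
  -- there.
  obtain ⟨F₀, ⟨G, rfl, hG, -⟩, hF₀⟩ := hf 0 (Nat.zero_le n)
  have hg : LocallyIntegrableOn (fun t => G 0 t + ubar t • (kernelHw ha hk : Hw a n)) (Ici 0) :=
    (hG 0 le_rfl).add (hubar.continuousOn.smul continuousOn_const).locallyIntegrableOn_Ici
  obtain ⟨U, hU, hUe⟩ := exists_linear_ode_solution (evolOp ha hk : Hw a n →L[ℝ] Hw a n) uin hg
  refine ⟨U, hU, by simpa using hUe 0 le_rfl, fun j hj1 hjn => ?_⟩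
  obtain ⟨i, rfl⟩ : ∃ i, j = i + 1 := ⟨j - 1, by omega⟩
  -- In H^{n-i-1}_a, f is W^{i+1,1}, hence C^i, so the solution gains one order and is C^{i+1}
  -- there.
  obtain ⟨F₁, hF₁, hF₁f⟩ := hf (i + 1) hjn
  obtain ⟨F, hF, hFe⟩ := hF₁.exists_contDiffOn
  have hFf : ∀ᵐ t ∂(volume.restrict (Ioi 0)), toL2 (F t) = f t := by
    filter_upwards [hF₁f, hFe] with t h1 h2
    rw [← h2, h1]
  set S : Hw a n →L[ℝ] Hw a (n - (i + 1)) := Hw.shift 0 (Nat.sub_le n (i + 1)) with hS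
  have hSG : ∀ᵐ t ∂(volume.restrict (Ioi 0)),
      S (G 0 t + ubar t • (kernelHw ha hk : Hw a n)) = F t + ubar t • kernelHw ha hk := by
    filter_upwards [hFf, hF₀] with t h1 h2
    rw [map_add, map_smul, hS, Hw.shift_zero_kernelHw]
    congr 1
    apply Hw.toL2_injective
    rw [h1, Hw.toL2_shift, Hw.comp_zero_apply]
    exact h2
  have hh : ContDiffOn ℝ i (fun t => F t + ubar t • (kernelHw ha hk : Hw a (n - (i + 1)))) (Ici 0) :=
    hF.add ((hubar.of_le (by exact_mod_cast (by omega : i ≤ n - 1))).smul contDiffOn_const)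
  have hV := contDiffOn_of_linear_ode (evolOp ha hk) (V := fun t => S (U t)) (v₀ := S uin)
    (S.continuous.comp_continuousOn hU) hh fun t ht => by
      have hAU : ContinuousOn (fun s => evolOp ha hk (U s)) (Ici 0) :=
        (evolOp ha hk).continuous.comp_continuousOn hU
      rw [hUe t ht, map_add, map_add, ← S.intervalIntegral_comp_comm
          (intervalIntegrable_of_locallyIntegrableOn hg le_rfl ht),
        ← S.intervalIntegral_comp_comm (intervalIntegrable_of_locallyIntegrableOn
          hAU.locallyIntegrableOn_Ici le_rfl ht), intervalIntegral_congr_ae_Ioi ht hSG]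
      simp only [hS, Hw.shift_zero_evolOp]
  exact ⟨F, hF, hFf, hV.1, hV.2⟩

/-- The derivatives ∂ₓ²u, ∂ₜ∂ₓu and ∂ₜ²u come from the levels j = 0, 1, 2 respectively, each
continuous in time into H^1_a. -/
theorem exists_contDiffOn_two_of_memX {u : ℝ → L2w a} (hu : MemX a 3 u) :
    ∃ U : ℝ × ℝ → ℝ, ContDiffOn ℝ 2 U (Ici 0 ×ˢ Ici 0) ∧
      ∀ t ≥ 0, ∀ᵐ x ∂(volume.restrict (Ioi 0)), u t x = U (t, x) := by
  obtain ⟨U₀, hU₀, e₀⟩ := hu 0 (by norm_num)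
  obtain ⟨U₁, hU₁, e₁⟩ := hu 1 (by norm_num)
  obtain ⟨U₂, hU₂, e₂⟩ := hu 2 (by norm_num)
  change ℝ → Hw a 3 at U₀
  change ℝ → Hw a 2 at U₁
  change ℝ → Hw a 1 at U₂
  obtain ⟨D₁, hD₁, hd₁⟩ := exists_hasDerivWithinAt_of_contDiffOn (j := 0) hU₁
  change ℝ → Hw a 2 at D₁
  obtain ⟨D₂, hD₂, hd₂⟩ := exists_hasDerivWithinAt_of_contDiffOn (j := 1) hU₂
  change ℝ → Hw a 1 at D₂
  obtain ⟨D₃, hD₃, hd₃⟩ := exists_hasDerivWithinAt_of_contDiffOn (j := 0) hD₂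
  have e₀₁ : ∀ t ≥ 0, U₁ t = Hw.shift 0 (by norm_num) (U₀ t) := fun t ht => by
    apply Hw.toL2_injective
    rw [e₁ t ht, Hw.toL2_shift, Hw.comp_zero_apply, e₀ t ht]
  have e₀₂ : ∀ t ≥ 0, U₂ t = Hw.shift 0 (by norm_num) (U₀ t) := fun t ht => by
    apply Hw.toL2_injective
    rw [e₂ t ht, Hw.toL2_shift, Hw.comp_zero_apply, e₀ t ht]
  have e₁₂ : ∀ t ≥ 0, U₂ t = Hw.shift 0 (by norm_num) (U₁ t) := fun t ht => by
    apply Hw.toL2_injective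
    rw [e₂ t ht, Hw.toL2_shift, Hw.comp_zero_apply, e₁ t ht]
  -- The time derivatives taken in H^1_a and in H^2_a agree, so ∂ₓ may be applied to ∂ₜu.
  have eD : ∀ t ≥ 0, D₂ t = Hw.shift 0 (by norm_num) (D₁ t) := fun t ht => by
    have h1 : HasDerivWithinAt U₂ (Hw.shift 0 (by norm_num) (D₁ t)) (Ici 0) t :=
      ((Hw.shift 0 (by norm_num : 1 + 0 ≤ 2)).hasFDerivAt.comp_hasDerivWithinAt t
        (hd₁ t ht)).congr_of_mem e₁₂ ht
    exact (uniqueDiffOn_Ici 0 t ht).eq_deriv _ (hd₂ t ht) h1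
  have e₁s : ∀ t ≥ 0, Hw.shift 1 (by norm_num) (U₁ t)
      = (Hw.shift 1 (by norm_num) (U₀ t) : Hw a 1) := fun t ht => by
    apply Hw.toL2_injective
    rw [e₀₁ t ht, Hw.toL2_shift, Hw.toL2_shift, Hw.comp_shift _ (by norm_num)]
  have evt : ∀ {V D : ℝ → Hw a 1}, (∀ t ≥ 0, HasDerivWithinAt V (D t) (Ici 0) t) →
      ∀ t ≥ 0, ∀ x : ℝ, HasDerivWithinAt (fun t => evalAt a x (V t)) (evalAt a x (D t)) (Ici 0) t :=
    fun h t ht x => (evalAt a x).hasFDerivAt.comp_hasDerivWithinAt t (h t ht)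
  have cont : ∀ {m n s : ℕ} (h : m + s ≤ n) {V : ℝ → Hw a n}, ContinuousOn V (Ici 0) →
      ContinuousOn (fun t => (Hw.shift s h (V t) : Hw a m)) (Ici 0) := fun h _ hV =>
    (Hw.shift _ h).continuous.comp_continuousOn hV
  have hQ : ContDiffOn ℝ (1 : ℕ) (fun p : ℝ × ℝ =>
      evalAt a p.2 (Hw.shift 1 (by norm_num : 1 + 1 ≤ 3) (U₀ p.1))) (Ici 0 ×ˢ Ici 0) := by
    refine contDiffOn_succ_of_partials (j := 0)
      (P := fun p => evalAt a p.2 (Hw.shift 1 (by norm_num : 1 + 1 ≤ 2) (D₁ p.1)))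
      (Q := fun p => evalAt a p.2 (Hw.shift 2 (by norm_num : 1 + 2 ≤ 3) (U₀ p.1)))
      (contDiffOn_zero.2 (continuousOn_evalAt_prod (cont (by norm_num : 1 + 1 ≤ 2) hD₁.continuousOn)))
      (contDiffOn_zero.2 (continuousOn_evalAt_prod (cont (by norm_num : 1 + 2 ≤ 3) hU₀.continuousOn)))
      (fun t ht x hx => ?_) (fun t ht x hx => hasDerivWithinAt_evalAt (by norm_num) (U₀ t) hx)
    refine evt (V := fun t => Hw.shift 1 (by norm_num : 1 + 1 ≤ 3) (U₀ t))
      (D := fun t => Hw.shift 1 (by norm_num : 1 + 1 ≤ 2) (D₁ t)) (fun t ht => ?_) t ht x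
    exact ((Hw.shift 1 (by norm_num : 1 + 1 ≤ 2)).hasFDerivAt.comp_hasDerivWithinAt t
      (hd₁ t ht)).congr_of_mem (fun s hs => (e₁s s hs).symm) ht
  have hP : ContDiffOn ℝ (1 : ℕ) (fun p : ℝ × ℝ => evalAt a p.2 (D₂ p.1)) (Ici 0 ×ˢ Ici 0) := by
    refine contDiffOn_succ_of_partials (j := 0)
      (P := fun p => evalAt a p.2 (D₃ p.1))
      (Q := fun p => evalAt a p.2 (Hw.shift 1 (by norm_num : 1 + 1 ≤ 2) (D₁ p.1)))
      (contDiffOn_zero.2 (continuousOn_evalAt_prod hD₃.continuousOn))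
      (contDiffOn_zero.2 (continuousOn_evalAt_prod (cont (by norm_num : 1 + 1 ≤ 2) hD₁.continuousOn)))
      (fun t ht x hx => evt hd₃ t ht x) (fun t ht x hx => ?_)
    simp only [eD t ht]
    exact hasDerivWithinAt_evalAt (by norm_num) (D₁ t) hx
  refine ⟨fun p => evalAt a p.2 (Hw.shift 0 (by norm_num : 1 + 0 ≤ 3) (U₀ p.1)), ?_, fun t ht => ?_⟩
  · refine contDiffOn_succ_of_partials (j := 1) hP hQ (fun t ht x hx => ?_)
      (fun t ht x hx => hasDerivWithinAt_evalAt (by norm_num) (U₀ t) hx)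
    refine evt (V := fun t => Hw.shift 0 (by norm_num : 1 + 0 ≤ 3) (U₀ t)) (fun t ht => ?_) t ht x
    exact (hd₂ t ht).congr_of_mem (fun s hs => (e₀₂ s hs).symm) ht
  · have := ae_eq_evalAt (Hw.shift 0 (by norm_num : 1 + 0 ≤ 3) (U₀ t))
    rwa [Hw.toL2_shift, Hw.comp_zero_apply, e₀ t ht] at this

theorem MemX.mono {a : ℝ} {n m : ℕ} {u : ℝ → L2w a} (hu : MemX a n u) (h : m ≤ n) :
    MemX a m u := by
  intro j hj
  obtain ⟨U, hU, hUu⟩ := hu j (hj.trans h)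
  refine ⟨fun t => Hw.shift 0 (by omega) (U t),
    (Hw.shift 0 (by omega : m - j + 0 ≤ n - j)).contDiff.comp_contDiffOn hU, fun t ht => ?_⟩
  rw [Hw.toL2_shift, Hw.comp_zero_apply, hUu t ht]

theorem exists_solution (μ : ℝ) {a : ℝ} (ha : 0 < a) {m : ℕ} {f : ℝ → L2w a}
    (hf : MemY a (m + 2) f) (uin : Hw a (m + 2)) {ubar : ℝ → ℝ} (hubar : MemWLoc (m + 2) ubar)
    (hubarc : ContinuousOn ubar (Ici 0)) (hcompat₁ : HasTrace (toL2 uin) (ubar 0))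
    (hcompat₂ : ∀ᵐ t ∂(volume.restrict (Ioi 0)), HasTrace (f t) (deriv ubar t)) :
    ∃ u : ℝ → L2w a, MemX a (m + 2) u ∧ IsSolution μ a f ubar (toL2 uin) u ∧ MemX a 1 u := by
  have hk := isDerivSeq_kernelDeriv μ
  -- As the order is at least 2, ubar has a continuous derivative g.
  obtain ⟨g, hg, hgd⟩ := hubar.exists_hasDerivWithinAt hubarc
  have hubarC : ContDiffOn ℝ ((m + 2 - 1 : ℕ) : WithTop ℕ∞) ubar (Ici 0) :=
    contDiffOn_succ_of_hasDerivWithinAt hgd hg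
  obtain ⟨U, hU, hU0, hreg⟩ := exists_reduced_solution ha hk hf uin hubarC
  have hX : MemX a (m + 2) fun t => toL2 (U t) := by
    intro j hj
    rcases Nat.eq_zero_or_pos j with rfl | hj1
    · exact ⟨U, contDiffOn_zero.2 hU, fun t _ => rfl⟩
    · obtain ⟨F, -, -, h, -⟩ := hreg j hj1 hj
      exact ⟨_, h, fun t _ => by rw [Hw.toL2_shift, Hw.comp_zero_apply]⟩
  refine ⟨fun t => toL2 (U t), hX, ?_, hX.mono (by omega)⟩
  -- At j = 1 the solution is C¹ in time and still has at least one space derivative, so traces make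
  -- sense.
  obtain ⟨F, hF, hFf, -, hd⟩ := hreg 1 le_rfl (by omega)
  set S : Hw a (m + 2) →L[ℝ] Hw a (m + 2 - 1) := Hw.shift 0 (Nat.sub_le (m + 2) 1) with hS
  have hSU : ∀ w, toL2 (S w) = toL2 w := fun w => by
    rw [hS, Hw.toL2_shift, Hw.comp_zero_apply]
  have h10 : 1 + 0 ≤ m + 2 - 1 := by omega
  have hR : ∀ w : Hw a (m + 2 - 1), toL2 (Hw.shift 0 h10 w : Hw a 1) = toL2 w := fun w => by
    rw [Hw.toL2_shift, Hw.comp_zero_apply]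
  set τ : Hw a (m + 2 - 1) →L[ℝ] ℝ := (trace a).comp (Hw.shift 0 h10) with hτ
  have hτt : ∀ w, HasTrace (toL2 w) (τ w) := fun w => by
    rw [← hR]
    exact hasTrace_trace _
  have hτe : ∀ (w : Hw a (m + 2 - 1)) (c : ℝ), HasTrace (toL2 w) c → τ w = c := fun w c h =>
    trace_eq_of_hasTrace ((congrArg (HasTrace · c) (hR w)).mpr h)
  -- Both sides are continuous in time, so the second compatibility condition extends from almost
  -- every t to all t ≥ 0.
  have hFg : EqOn (fun t => τ (F t)) g (Ici 0) := by
    refine eqOn_Ici_of_ae_eq ?_ (τ.continuous.comp_continuousOn hF.continuousOn) hg.continuousOn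
    filter_upwards [hcompat₂, hFf, ae_restrict_mem measurableSet_Ioi] with t h1 h2 ht
    have ht0 : (0 : ℝ) < t := ht
    rw [← h2, ((hgd t ht0.le).hasDerivAt (Ici_mem_nhds ht0)).deriv] at h1
    exact hτe _ _ h1
  have hτU : ∀ t ≥ 0, τ (S (U t)) = ubar t := by
    intro t ht
    -- The boundary defect y - ubar satisfies a homogeneous equation with coefficient -k(0): f(t,0)
    -- cancels ubar', and the trace k(0) of the kernel supplies k(0) ubar.
    have hde : ∀ t ≥ 0, HasDerivWithinAt (fun t => τ (S (U t)) - ubar t)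
        ((-(kernelDeriv μ 0 0) • ContinuousLinearMap.id ℝ ℝ) (τ (S (U t)) - ubar t)) (Ici 0) t := by
      intro t ht
      refine ((τ.hasFDerivAt.comp_hasDerivWithinAt t (hd t ht)).sub (hgd t ht)).congr_deriv ?_
      have e1 : τ (evolOp ha hk (S (U t))) = -(kernelDeriv μ 0 0 * τ (S (U t))) :=
        trace_shift_evolOp ha hk h10 _
      have e2 : τ (kernelHw ha hk) = kernelDeriv μ 0 0 := by
        rw [hτ, ContinuousLinearMap.comp_apply, Hw.shift_zero_kernelHw, trace_kernelHw]
      rw [map_add, map_add, map_smul, e1, e2, show τ (F t) = g t from hFg ht]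
      simp only [smul_eq_mul, smul_apply, ContinuousLinearMap.id_apply]
      ring
    have hc : ContinuousOn (fun t => τ (S (U t)) - ubar t) (Ici 0) := fun t ht =>
      (hde t ht).continuousWithinAt
    -- The first compatibility condition makes the initial defect vanish.
    have h0 : τ (S (U 0)) = ubar 0 := hτe _ _ (by rwa [hSU, hU0])
    refine sub_eq_zero.1 (eq_zero_of_eq_integral
      (-(kernelDeriv μ 0 0) • ContinuousLinearMap.id ℝ ℝ) hc (fun s hs => ?_) ht)
    rw [eq_add_integral_of_hasDerivWithinAt hde
      ((ContinuousLinearMap.continuous _).comp_continuousOn hc) hs, h0, sub_self, zero_add]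
  have hbdry : ∀ t ≥ 0, HasTrace (toL2 (U t)) (ubar t) := fun t ht => by
    rw [← hSU, ← hτU t ht]
    exact hτt _
  refine ⟨?_, hbdry, by rw [hU0]⟩
  filter_upwards [hFf, ae_restrict_mem measurableSet_Ioi] with t hft ht
  have ht0 : (0 : ℝ) < t := ht
  set D : Hw a (m + 2 - 1) := evolOp ha hk (S (U t)) + (F t + ubar t • kernelHw ha hk) with hD
  refine ⟨toL2 D, Hw.comp 1 (U t), ?_, Hw.hasWeakDeriv_toL2 (by omega) _, ?_⟩
  · have h1 := (Hw.comp 0).hasFDerivAt.comp_hasDerivAt t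
      ((hd t ht0.le).hasDerivAt (Ici_mem_nhds ht0))
    rw [← Hw.comp_zero_apply]
    refine h1.congr_of_eventuallyEq (Eventually.of_forall fun s => ?_)
    simp only [Function.comp_apply]
    rw [Hw.comp_zero_apply, hSU]
  -- With the boundary condition established, the integration by parts is reversed to recover the
  -- original equation.
  · have hDt : toL2 D = -(kernelDeriv μ 0 0 • toL2 (U t) + convL2 ha hk 1 (toL2 (U t)))
        + (f t + ubar t • (memLp_kernel ha hk 0).toLp _) := by
      rw [← hSU (U t), ← toL2_evolOp, ← hft, ← toL2_kernelHw (n := m + 2 - 1)]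
      rfl
    rw [hDt, ← kernelDeriv_zero]
    filter_upwards [causalConv_weakDeriv ha hk (Hw.hasWeakDeriv_toL2 (by omega) (U t))
        (hbdry t ht0.le),
      L2w.coeFn_add_Ioi (-(kernelDeriv μ 0 0 • toL2 (U t) + convL2 ha hk 1 (toL2 (U t))))
        (f t + ubar t • (memLp_kernel ha hk 0).toLp _),
      ae_weightedMeasure_iff.1 (Lp.coeFn_neg
        (kernelDeriv μ 0 0 • toL2 (U t) + convL2 ha hk 1 (toL2 (U t)))),
      L2w.coeFn_add_Ioi (kernelDeriv μ 0 0 • toL2 (U t)) (convL2 ha hk 1 (toL2 (U t))),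
      L2w.coeFn_smul_Ioi (kernelDeriv μ 0 0) (toL2 (U t)),
      L2w.coeFn_add_Ioi (f t) (ubar t • (memLp_kernel ha hk 0).toLp _),
      L2w.coeFn_smul_Ioi (ubar t) ((memLp_kernel ha hk 0).toLp _ : L2w a),
      coeFn_toLp_kernel ha hk 0] with x e1 e2 e3 e4 e5 e6 e7 e8
    rw [e1, e2, e3, Pi.neg_apply, e4, e5, e6, e7, e8]
    ring

end Solution

end

end NonlocalTransport

theorem mainTheorem12 (μ : ℝ) (hμ : 0 < μ) (a : ℝ) (ha : 0 < a) (n : ℕ) (hn : n = 2 ∨ n = 3)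
    (f : ℝ → NonlocalTransport.L2w a) (hf : NonlocalTransport.MemY a n f)
    (uin : NonlocalTransport.Hw a n)
    (ubar : ℝ → ℝ) (hubar : NonlocalTransport.MemWLoc n ubar) (hubarc : ContinuousOn ubar (Ici 0))
    (hcompat₁ : NonlocalTransport.HasTrace (NonlocalTransport.toL2 uin) (ubar 0))
    (hcompat₂ : ∀ᵐ t ∂(volume.restrict (Ioi 0)), NonlocalTransport.HasTrace (f t) (deriv ubar t)) :
    ∃ u : ℝ → NonlocalTransport.L2w a,
      NonlocalTransport.MemX a 1 u ∧ NonlocalTransport.IsSolution μ a f ubar (NonlocalTransport.toL2 uin) u ∧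
      (∀ v : ℝ → NonlocalTransport.L2w a, NonlocalTransport.MemX a 1 v →
        NonlocalTransport.IsSolution μ a f ubar (NonlocalTransport.toL2 uin) v → EqOn v u (Ici 0)) ∧
      NonlocalTransport.MemX a n u ∧
      (n = 3 → ∃ U : ℝ × ℝ → ℝ, ContDiffOn ℝ 2 U (Ici 0 ×ˢ Ici 0) ∧
        ∀ t ≥ 0, ∀ᵐ x ∂(volume.restrict (Ioi 0)), u t x = U (t, x)) := by
  obtain ⟨m, rfl⟩ : ∃ m, n = m + 2 := ⟨n - 2, by omega⟩
  obtain ⟨u, h1, h2, hX⟩ :=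
    NonlocalTransport.exists_solution μ ha hf uin hubar hubarc hcompat₁ hcompat₂
  exact ⟨u, hX, h2, fun v hv hsv => h2.unique ha hX hv hsv, h1, fun h =>
    NonlocalTransport.exists_contDiffOn_two_of_memX (h ▸ h1)⟩
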